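/- **Theorem 3.1 (Extended).** Let $\mathsf G=(\mathsf V,\mathsf E)$ be a countable, connected, locally finite simple graph with path distance $\rho$, vertex degrees $n(x)$ and a fixed root $o\in\mathsf V$. For $\alpha,\theta>0$ put $w_\alpha(x)=e^{-\alpha\rho(o,x)}$ and $$\Theta(\alpha,\theta)=\sum_{x\in\mathsf V}w_\alpha(x)\sum_{y\sim x}[n(x)n(y)]^\theta .$$ Fix $\theta>0$ such that $\Theta(\alpha,\theta)<\infty$ for some $\alpha>0$, let $\underline\alpha=\inf\{\alpha>0:\Theta(\alpha,\theta)<\infty\}$, and let $\overline\alpha>\underline\alpha$ be such that $\Theta(\alpha,\theta)<\infty$ for all $\alpha\in(\underline\alpha,\overline\alpha]$. Let $W:\mathbb R\times\mathbb R\to\mathbb R$ be continuous and symmetric with $$|W(u,v)|\le \tfrac12\left[I_W+J_W(|u|^r+|v|^r)\right],\qquad u,v\in\mathbb R,$$ for some $r,I_W,J_W>0$, and let $V:\mathbb R\to\mathbb R$ be continuous with $V(u)\ge a_V|u|^q-c_V$ for all $u\in\mathbb R$, where $a_V,c_V>0$ and $q>p_0:=r+r/\theta$. Let $\Omega=\mathbb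 R^{\mathsf V}$ with the product topology and its Borel $\sigma$-field. For a finite non-empty $\Lambda\subset\mathsf V$ and $\xi\in\Omega$ put $$H_\Lambda(\omega_\Lambda|\xi)=\sum_{\langle x,y\rangle\in\mathsf E:\,x,y\in\Lambda}W(\omega(x),\omega(y))+\sum_{\langle x,y\rangle\in\mathsf E:\,x\in\Lambda,\,y\in\Lambda^c}W(\omega(x),\xi(y))+\sum_{x\in\Lambda}V(\omega(x)),$$ $$\pi_\Lambda(A|\xi)=\frac1{Z_\Lambda(\xi)}\int_{\mathbb R^{\Lambda}}\mathbb I_A(\omega_\Lambda\times\xi_{\Lambda^c})\,e^{-H_\Lambda(\omega_\Lambda|\xi)}\,d\omega_\Lambda,$$ where $Z_\Lambda(\xi)$ is the normalizing factor. Let $\mathcal G$ be the set of Borel probability measures $\mu$ on $\Omega$ with $\mu(A)=\int_\Omega\pi_\Lambda(A|\xi)\,\mu(d\xi)$ for all Borel $A\subset\Omega$ and all finite non-empty $\Lambda\subset\mathsf V$. For $p,\alpha>0$ let $\|\omega\|_{p,\alpha}=\left[\sum_{x}|\omega(x)|^pw_\alpha(x)\right]^{1/p}\in[0,\infty]$,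 $L^p(\mathsf V,w_\alpha)=\{\omega\in\Omega:\|\omega\|_{p,\alpha}<\infty\}$ and $$\mathcal G_{p,\alpha}=\{\mu\in\mathcal G:\mu[L^p(\mathsf V,w_\alpha)]=1\}.$$ Then for every $\alpha\in(\underline\alpha,\overline\alpha]$ and $p\in[p_0,q)$ the set $\mathcal G_{p,\alpha}$ is non-empty and compact in the weak topology (the one determined by bounded continuous functions on $\Omega$). For every $\lambda>0$ and $x\in\mathsf V$ there is a constant $C(p,\alpha;\lambda,x)>0$ such that, for all $\mu\in\mathcal G_{p,\alpha}$, $$\int_\Omega\exp\left(\lambda|\omega(x)|^p\right)\mu(d\omega)\le C(p,\alpha;\lambda,x).$$ Furthermore, for every $\lambda>0$ there is a constant $C(p,\alpha;\lambda)>0$ such that, for all $\mu\in\mathcal G_{p,\alpha}$, $$\int_\Omega\exp\left(\lambda\|\omega\|_{p,\alpha}^p\right)\mu(d\omega)\le C(p,\alpha;\lambda).$$ -/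

import Mathlib

open MeasureTheory
open scoped ENNReal

namespace UnboundedSpin

noncomputable section

/-- The weight `w_α(x) = exp(-α ρ(o,x))`, where `ρ` is the path distance and `o` the root. -/
def weight {V : Type*} (G : SimpleGraph V) (o : V) (α : ℝ) (x : V) : ℝ :=
  Real.exp (-α * (G.dist o x : ℝ))

/-- `m_θ(x) = ∑_{y ∼ x} [n(x) n(y)]^θ`, where `n` is the vertex degree. -/
def degreeSum {V : Type*} (G : SimpleGraph V) [G.LocallyFinite] (θ : ℝ) (x : V) : ℝ :=
  ∑ y ∈ G.neighborFinset x, ((G.degree x : ℝ) * (G.degree y : ℝ)) ^ θ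

/-- `Θ(α,θ) = ∑_x m_θ(x) w_α(x)`, a sum of non-negative terms with value in `[0,∞]`. -/
def Theta {V : Type*} (G : SimpleGraph V) [G.LocallyFinite] (o : V) (α θ : ℝ) : ℝ≥0∞ :=
  ∑' x, ENNReal.ofReal (degreeSum G θ x * weight G o α x)

/-- The infimum of all positive `α` with `Θ(α,θ) < ∞`. -/
def alphaLow {V : Type*} (G : SimpleGraph V) [G.LocallyFinite] (o : V) (θ : ℝ) : ℝ :=
  sInf {α : ℝ | 0 < α ∧ Theta G o α θ < ∞}

open Classical in
/-- The configuration `ω_Λ × ξ_{Λᶜ}`. -/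
def glue {V : Type*} (Λ : Finset V) (ξ : V → ℝ) (ω : Λ → ℝ) : V → ℝ :=
  fun x => if h : x ∈ Λ then ω ⟨x, h⟩ else ξ x

open Classical in
/-- The relative local Hamiltonian `H_Λ(η_Λ | ξ)`; it reads `η` only on `Λ` and `ξ` only off `Λ`.
The pair interaction inside `Λ` is a sum over unordered edges: as `W` is symmetric and there are
no loops, that is half of the sum over ordered pairs of adjacent vertices. -/
def hamiltonian {V : Type*} (G : SimpleGraph V) [G.LocallyFinite] (W : ℝ → ℝ → ℝ) (U : ℝ → ℝ)
    (Λ : Finset V) (ξ η : V → ℝ) : ℝ :=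
  (1 / 2) * (∑ x ∈ Λ, ∑ y ∈ G.neighborFinset x with y ∈ Λ, W (η x) (η y))
    + (∑ x ∈ Λ, ∑ y ∈ G.neighborFinset x with y ∉ Λ, W (η x) (ξ y))
    + ∑ x ∈ Λ, U (η x)

/-- The Boltzmann factor `exp(-H_Λ(ω_Λ | ξ))`. -/
def boltzmann {V : Type*} (G : SimpleGraph V) [G.LocallyFinite] (W : ℝ → ℝ → ℝ) (U : ℝ → ℝ)
    (Λ : Finset V) (ξ : V → ℝ) (ω : Λ → ℝ) : ℝ≥0∞ :=
  ENNReal.ofReal (Real.exp (-hamiltonian G W U Λ ξ (glue Λ ξ ω)))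

/-- The normalizing factor `Z_Λ(ξ)`. -/
def partition {V : Type*} (G : SimpleGraph V) [G.LocallyFinite] (W : ℝ → ℝ → ℝ) (U : ℝ → ℝ)
    (Λ : Finset V) (ξ : V → ℝ) : ℝ≥0∞ :=
  ∫⁻ ω : Λ → ℝ, boltzmann G W U Λ ξ ω

/-- The local Gibbs specification:
`π_Λ(A|ξ) = Z_Λ(ξ)⁻¹ ∫ 1_A(ω_Λ × ξ_{Λᶜ}) exp(-H_Λ(ω_Λ|ξ)) dω_Λ`. -/
def gibbsSpec {V : Type*} (G : SimpleGraph V) [G.LocallyFinite] (W : ℝ → ℝ → ℝ) (U : ℝ → ℝ)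
    (Λ : Finset V) (ξ : V → ℝ) : Measure (V → ℝ) :=
  (partition G W U Λ ξ)⁻¹ •
    ((volume : Measure (Λ → ℝ)).withDensity (boltzmann G W U Λ ξ)).map (glue Λ ξ)

/-- The Gibbs random fields: probability measures on `ℝ^V` that solve the DLR equation for every
finite non-void `Λ` and every measurable `A`. -/
def gibbsMeasures {V : Type*} (G : SimpleGraph V) [G.LocallyFinite] (W : ℝ → ℝ → ℝ)
    (U : ℝ → ℝ) : Set (ProbabilityMeasure (V → ℝ)) :=
  {μ | ∀ Λ : Finset V, Λ.Nonempty → ∀ A : Set (V → ℝ), MeasurableSet A →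
    (μ : Measure (V → ℝ)) A = ∫⁻ ξ, gibbsSpec G W U Λ ξ A ∂(μ : Measure (V → ℝ))}

/-- `‖ω‖_{p,α} = [∑_x |ω(x)|^p w_α(x)]^{1/p}`, with value in `[0,∞]`. -/
def lpNorm {V : Type*} (G : SimpleGraph V) (o : V) (p α : ℝ) (ω : V → ℝ) : ℝ≥0∞ :=
  (∑' x, ENNReal.ofReal (|ω x| ^ p * weight G o α x)) ^ (1 / p)

/-- The weighted space `L^p(V, w_α)`. -/
def lpSpace {V : Type*} (G : SimpleGraph V) (o : V) (p α : ℝ) : Set (V → ℝ) :=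
  {ω | lpNorm G o p α ω < ∞}

/-- The set `𝒢_{p,α}` of Gibbs random fields supported on `L^p(V, w_α)`. -/
def temperedGibbs {V : Type*} (G : SimpleGraph V) [G.LocallyFinite] (o : V)
    (W : ℝ → ℝ → ℝ) (U : ℝ → ℝ) (p α : ℝ) : Set (ProbabilityMeasure (V → ℝ)) :=
  {μ | μ ∈ gibbsMeasures G W U ∧ (μ : Measure (V → ℝ)) (lpSpace G o p α) = 1}

end

end UnboundedSpin

namespace UnboundedSpin

/-! ### Elementary inequalities and one-dimensional integrability. -/

section

/-! Everything rests on one bound for the specification (`exists_lintegral_exp_sum_gibbsSpec_le`):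
for each λ > 0 there is A, independent of Λ and ξ, such that the mean of exp(λ ∑_{x∈Λ} |η(x)|^p
w(x)) under π_Λ(·|ξ) is at most exp(A + λ ∑_{y∈∂Λ} |ξ(y)|^p w(y)).

The bound starts at one site. As p ≥ r + r/θ, one has |u|^r ≤ ε|u|^p/N + K N^θ with N = n(x)n(y)
(`rpow_le_mul_rpow_div_add`). Over the neighbours y of x, the N^θ add up to m_θ(x), which is
summable against w, and the 1/N add up to at most 1. As p < q, the self-interaction controls any
multiple of |u|^p. So the logarithm of the one-site moment is at most C₁ + C₂ m_θ(x) plus ε times a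
neighbour average of |ξ|^p, with ε arbitrarily small (`exists_one_site_bound`). Consistency of the
specification and Hölder's inequality turn this into linear inequalities between the logarithmic
moments of π_Λ (`logMoment_le`). After summation against w, whose values at adjacent vertices differ
by a factor at most e^α, the choice ε e^α = λ/2 absorbs the interior terms. A second use of Hölder,
with exponents proportional to w, gives the bound.

For a tempered Gibbs measure the boundary term vanishes almost surely as Λ grows, so the DLR
equation leaves the bound e^A, hence both moment estimates. Thus temperedness, in general not a
closed condition, coincides on Gibbs measures with a uniform moment bound (`temperedGibbs_eq`). The
latter defines a compact set, by Markov, Prokhorov and lower semicontinuity, and the Feller property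
makes the DLR equations closed. A Gibbs measure arises as a limit of π_Λ(·|0). -/

theorem exists_rpow_le_mul_rpow_add {s t : ℝ} (hs : 0 < s) (hst : s < t) {δ : ℝ} (hδ : 0 < δ) :
    ∃ C : ℝ, 0 ≤ C ∧ ∀ x : ℝ, 0 ≤ x → x ^ s ≤ δ * x ^ t + C := by
  -- The constant is the value of x^s at the threshold beyond which δ x^(t-s) ≥ 1.
  refine ⟨(δ⁻¹ ^ (1 / (t - s))) ^ s, by positivity, fun x hx => ?_⟩
  rcases le_total x (δ⁻¹ ^ (1 / (t - s))) with h | h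
  · have h1 := Real.rpow_le_rpow hx h hs.le
    have h2 : 0 ≤ δ * x ^ t := by positivity
    linarith
  · have hx0 : 0 < x := lt_of_lt_of_le (by positivity) h
    have h1 : δ⁻¹ ≤ x ^ (t - s) := by
      have := Real.rpow_le_rpow (by positivity) h (sub_nonneg.2 hst.le)
      rwa [← Real.rpow_mul (by positivity), one_div, inv_mul_cancel₀ (sub_pos.2 hst).ne',
        Real.rpow_one] at this
    have h2 : x ^ t = x ^ s * x ^ (t - s) := by
      rw [← Real.rpow_add hx0]; congr 1; ring
    have h3 : 1 ≤ δ * x ^ (t - s) := by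
      have := mul_le_mul_of_nonneg_left h1 hδ.le
      rwa [mul_inv_cancel₀ hδ.ne'] at this
    have h4 : x ^ s * 1 ≤ x ^ s * (δ * x ^ (t - s)) :=
      mul_le_mul_of_nonneg_left h3 (by positivity)
    have h5 : 0 ≤ (δ⁻¹ ^ (1 / (t - s))) ^ s := by positivity
    rw [h2]; nlinarith

/-- If x^r exceeds (K N)^θ with K = max 1 ε⁻¹, then x^(r/θ) ≥ K N ≥ 1, so x ≥ 1 and x^(p-r) ≥
x^(r/θ) ≥ N/ε. This is the step that forces the threshold r + r/θ. -/
theorem rpow_le_mul_rpow_div_add {r θ p ε N x : ℝ} (hr : 0 < r) (hθ : 0 < θ)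
    (hp : r + r / θ ≤ p) (hε : 0 < ε) (hN : 1 ≤ N) (hx : 0 ≤ x) :
    x ^ r ≤ ε * (x ^ p / N) + (max 1 ε⁻¹) ^ θ * N ^ θ := by
  set K := max 1 ε⁻¹ with hK
  have hK1 : 1 ≤ K := le_max_left _ _
  have hKε : ε⁻¹ ≤ K := le_max_right _ _
  have hKN : 1 ≤ K * N := one_le_mul_of_one_le_of_one_le hK1 hN
  have hN0 : 0 < N := by linarith
  rw [← Real.mul_rpow (by linarith) (by linarith)]
  rcases le_total (x ^ r) ((K * N) ^ θ) with h | h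
  · have : 0 ≤ ε * (x ^ p / N) := by positivity
    linarith
  · have hrθ : 0 < r / θ := by positivity
    have hx0 : 0 < x := by
      rcases hx.lt_or_eq with hx | hx
      · exact hx
      · rw [← hx, Real.zero_rpow hr.ne'] at h
        have : 0 < (K * N) ^ θ := by positivity
        linarith
    have h1 : K * N ≤ x ^ (r / θ) := by
      have := Real.rpow_le_rpow (by positivity) h (inv_nonneg.2 hθ.le)
      rwa [← Real.rpow_mul (by positivity), mul_inv_cancel₀ hθ.ne', Real.rpow_one,
        ← Real.rpow_mul hx] at this
    have hx1 : 1 ≤ x := by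
      by_contra! hlt
      have := Real.rpow_lt_one hx hlt hrθ
      linarith
    have h2 : x ^ (r / θ) ≤ x ^ (p - r) := Real.rpow_le_rpow_of_exponent_le hx1 (by linarith)
    have h3 : x ^ p = x ^ r * x ^ (p - r) := by rw [← Real.rpow_add hx0]; congr 1; ring
    have h4 : ε⁻¹ * N ≤ x ^ (p - r) := by nlinarith
    have h5 : 1 ≤ ε * (x ^ (p - r) / N) := by
      rw [inv_mul_eq_div, div_le_iff₀ hε] at h4
      rw [mul_div_assoc', le_div_iff₀ hN0]; linarith
    have h6 : 0 ≤ (K * N) ^ θ := by positivity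
    have h7 : x ^ r * 1 ≤ x ^ r * (ε * (x ^ (p - r) / N)) :=
      mul_le_mul_of_nonneg_left h5 (by positivity)
    calc x ^ r ≤ x ^ r * (ε * (x ^ (p - r) / N)) := by linarith
      _ = ε * (x ^ p / N) := by rw [h3]; ring
      _ ≤ _ := by linarith

theorem rpow_le_one_add_rpow {s t x : ℝ} (hs : 0 ≤ s) (hst : s ≤ t) (hx : 0 ≤ x) :
    x ^ s ≤ 1 + x ^ t := by
  rcases le_total x 1 with h | h
  · have := Real.rpow_le_one hx h hs
    have : 0 ≤ x ^ t := by positivity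
    linarith
  · have := Real.rpow_le_rpow_of_exponent_le h hst
    linarith

/-- This is log t ≤ t^κ/κ for t = 1 + x² and κ = s/2. It makes 1/(1+u²) available as an integrable
majorant. -/
theorem one_add_sq_le_exp {s x : ℝ} (hs : 0 < s) (hx : 0 ≤ x) :
    1 + x ^ 2 ≤ Real.exp (2 ^ (s / 2) / (s / 2) * (1 + x ^ s)) := by
  have h1 : (1 + x ^ 2) ^ (s / 2) ≤ 2 ^ (s / 2) * (1 + x ^ s) := by
    have hsq : (x ^ 2) ^ (s / 2) = x ^ s := by
      rw [← Real.rpow_natCast, ← Real.rpow_mul hx]; congr 1; push_cast; ring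
    rcases le_total (x ^ 2) 1 with h | h
    · calc (1 + x ^ 2) ^ (s / 2) ≤ 2 ^ (s / 2) :=
            Real.rpow_le_rpow (by positivity) (by linarith) (by positivity)
        _ ≤ _ := le_mul_of_one_le_right (by positivity)
            (by have : 0 ≤ x ^ s := by positivity
                linarith)
    · calc (1 + x ^ 2) ^ (s / 2) ≤ (2 * x ^ 2) ^ (s / 2) :=
            Real.rpow_le_rpow (by positivity) (by linarith) (by positivity)
        _ = 2 ^ (s / 2) * x ^ s := by rw [Real.mul_rpow (by norm_num) (by positivity), hsq]
        _ ≤ _ := mul_le_mul_of_nonneg_left (by linarith) (by positivity)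
  have h2 := Real.log_le_rpow_div (x := 1 + x ^ 2) (by positivity) (half_pos hs)
  rw [← Real.log_le_iff_le_exp (by positivity)]
  refine h2.trans ?_
  rw [div_mul_eq_mul_div]
  gcongr

theorem integrable_exp_mul_rpow_sub {U : ℝ → ℝ} {a c q s L : ℝ} (hU : Continuous U)
    (ha : 0 < a) (hbd : ∀ u, a * |u| ^ q - c ≤ U u) (hs : 0 < s) (hsq : s < q) (hL : 0 ≤ L) :
    Integrable (fun u : ℝ => Real.exp (L * |u| ^ s - U u)) := by
  set D : ℝ := 2 ^ (s / 2) / (s / 2) with hD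
  have hD0 : 0 < D := by positivity
  -- With this δ, (L + D)|u|^s costs at most a|u|^q plus a constant, which the lower bound on `U`
  -- compensates exactly.
  obtain ⟨C, -, hC⟩ := exists_rpow_le_mul_rpow_add hs hsq (δ := a / (L + D)) (by positivity)
  refine Integrable.mono' (integrable_inv_one_add_sq.const_mul
    (Real.exp ((L + D) * C + D + c))) ?_ ?_
  · exact (Real.continuous_exp.comp (((continuous_const).mul
      (continuous_abs.rpow_const fun _ => Or.inr hs.le)).sub hU)).aestronglyMeasurable
  · refine Filter.Eventually.of_forall fun u => ?_
    rw [Real.norm_of_nonneg (Real.exp_pos _).le]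
    have h1 := one_add_sq_le_exp hs (abs_nonneg u)
    rw [sq_abs] at h1
    have h2 := hC |u| (abs_nonneg u)
    have h3 : (L + D) * |u| ^ s ≤ a * |u| ^ q + (L + D) * C := by
      have := mul_le_mul_of_nonneg_left h2 (by positivity : 0 ≤ L + D)
      have e : (L + D) * (a / (L + D) * |u| ^ q + C) = a * |u| ^ q + (L + D) * C := by
        field_simp
      linarith
    have h4 := hbd u
    rw [← div_eq_mul_inv, le_div_iff₀ (by positivity)]
    calc Real.exp (L * |u| ^ s - U u) * (1 + u ^ 2)
        ≤ Real.exp (L * |u| ^ s - U u) * Real.exp (D * (1 + |u| ^ s)) := by gcongr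
      _ = Real.exp (L * |u| ^ s - U u + D * (1 + |u| ^ s)) := (Real.exp_add _ _).symm
      _ ≤ _ := Real.exp_le_exp.2 (by nlinarith)

end

/-! ### Gluing of configurations, the local specification and its consistency. -/

section

variable {V : Type*}

theorem glue_of_mem {Λ : Finset V} (ξ : V → ℝ) (ω : Λ → ℝ) {x : V} (hx : x ∈ Λ) :
    glue Λ ξ ω x = ω ⟨x, hx⟩ := by
  simp [glue, hx]

theorem glue_of_notMem {Λ : Finset V} (ξ : V → ℝ) (ω : Λ → ℝ) {x : V} (hx : x ∉ Λ) :
    glue Λ ξ ω x = ξ x := by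
  simp [glue, hx]

theorem glue_eq_updateFinset [DecidableEq V] (Λ : Finset V) (ξ : V → ℝ) (ω : Λ → ℝ) :
    glue Λ ξ ω = Function.updateFinset ξ Λ ω := by
  ext x
  by_cases hx : x ∈ Λ <;> simp [glue, Function.updateFinset, hx]

theorem glue_congr {Λ : Finset V} {ξ ξ' : V → ℝ} (h : ∀ x ∉ Λ, ξ x = ξ' x) (ω : Λ → ℝ) :
    glue Λ ξ ω = glue Λ ξ' ω := by
  ext x
  by_cases hx : x ∈ Λ
  · simp [glue_of_mem, hx]
  · simp [glue_of_notMem, hx, h x hx]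

theorem continuous_glue (Λ : Finset V) :
    Continuous fun z : (V → ℝ) × (Λ → ℝ) => glue Λ z.1 z.2 := by
  refine continuous_pi fun x => ?_
  by_cases hx : x ∈ Λ
  · simp only [glue_of_mem _ _ hx]; fun_prop
  · simp only [glue_of_notMem _ _ hx]; fun_prop

theorem measurable_glue (Λ : Finset V) :
    Measurable fun z : (V → ℝ) × (Λ → ℝ) => glue Λ z.1 z.2 := by
  refine measurable_pi_lambda _ fun x => ?_
  by_cases hx : x ∈ Λ
  · simp only [glue_of_mem _ _ hx]; fun_prop
  · simp only [glue_of_notMem _ _ hx]; fun_prop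

theorem measurable_glue_right (Λ : Finset V) (ξ : V → ℝ) : Measurable (glue Λ ξ) :=
  (measurable_glue Λ).comp measurable_prodMk_left

/-- Integration of `f` over the spins in `Λ`, the others being frozen at `ξ`. -/
noncomputable def spinIntegral (Λ : Finset V) (f : (V → ℝ) → ℝ≥0∞) (ξ : V → ℝ) : ℝ≥0∞ :=
  ∫⁻ ω : Λ → ℝ, f (glue Λ ξ ω)

/-- The identification with marginal integrals provides measurability and Fubini's theorem. -/
theorem spinIntegral_eq_lmarginal [DecidableEq V] (Λ : Finset V) (f : (V → ℝ) → ℝ≥0∞) :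
    spinIntegral Λ f = lmarginal (fun _ => (volume : Measure ℝ)) Λ f := by
  ext ξ
  simp only [spinIntegral, lmarginal, glue_eq_updateFinset]
  rfl

theorem measurable_spinIntegral (Λ : Finset V) {f : (V → ℝ) → ℝ≥0∞} (hf : Measurable f) :
    Measurable (spinIntegral Λ f) := by
  classical
  rw [spinIntegral_eq_lmarginal]
  exact hf.lmarginal _

theorem spinIntegral_congr_boundary {Λ : Finset V} (f : (V → ℝ) → ℝ≥0∞) {ξ ξ' : V → ℝ}
    (h : ∀ x ∉ Λ, ξ x = ξ' x) : spinIntegral Λ f ξ = spinIntegral Λ f ξ' := by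
  simp only [spinIntegral, glue_congr h]

theorem spinIntegral_congr {Λ : Finset V} {f g : (V → ℝ) → ℝ≥0∞} {ξ : V → ℝ}
    (h : ∀ η : V → ℝ, (∀ x ∉ Λ, η x = ξ x) → f η = g η) :
    spinIntegral Λ f ξ = spinIntegral Λ g ξ :=
  lintegral_congr fun ω => h _ fun _ hx => glue_of_notMem ξ ω hx

theorem spinIntegral_mono {Λ : Finset V} {f g : (V → ℝ) → ℝ≥0∞} {ξ : V → ℝ}
    (h : ∀ η : V → ℝ, (∀ x ∉ Λ, η x = ξ x) → f η ≤ g η) :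
    spinIntegral Λ f ξ ≤ spinIntegral Λ g ξ :=
  lintegral_mono fun ω => h _ fun _ hx => glue_of_notMem ξ ω hx

theorem spinIntegral_mul_left {Λ : Finset V} {f g : (V → ℝ) → ℝ≥0∞} (hf : Measurable f)
    {ξ : V → ℝ} (h : ∀ η : V → ℝ, (∀ x ∉ Λ, η x = ξ x) → g η = g ξ) :
    spinIntegral Λ (fun η => g η * f η) ξ = g ξ * spinIntegral Λ f ξ := by
  rw [spinIntegral_congr (g := fun η => g ξ * f η) fun η hη => by rw [h η hη]]
  exact lintegral_const_mul _ (hf.comp (measurable_glue_right Λ ξ))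

theorem spinIntegral_sdiff [DecidableEq V] {Δ Λ : Finset V} (h : Δ ⊆ Λ) {f : (V → ℝ) → ℝ≥0∞}
    (hf : Measurable f) : spinIntegral Λ f = spinIntegral (Λ \ Δ) (spinIntegral Δ f) := by
  simp only [spinIntegral_eq_lmarginal]
  conv_lhs => rw [← Finset.sdiff_union_of_subset h]
  exact lmarginal_union _ f hf Finset.sdiff_disjoint

theorem spinIntegral_singleton [DecidableEq V] (x : V) (f : (V → ℝ) → ℝ≥0∞) (ξ : V → ℝ) :
    spinIntegral {x} f ξ = ∫⁻ u : ℝ, f (Function.update ξ x u) := by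
  rw [spinIntegral_eq_lmarginal, lmarginal_singleton]

variable (G : SimpleGraph V) [G.LocallyFinite] (W : ℝ → ℝ → ℝ) (U : ℝ → ℝ)

open Classical in
theorem hamiltonian_congr_boundary {Λ : Finset V} {ξ ξ' : V → ℝ} (h : ∀ x ∉ Λ, ξ x = ξ' x)
    (η : V → ℝ) : hamiltonian G W U Λ ξ η = hamiltonian G W U Λ ξ' η := by
  unfold hamiltonian
  congr 2
  refine Finset.sum_congr rfl fun x _ => Finset.sum_congr rfl fun y hy => ?_
  rw [h y (Finset.mem_filter.1 hy).2]

/-- The energy of all sites and edges that meet `Λ`. -/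
noncomputable def energy (Λ : Finset V) (η : V → ℝ) : ℝ := hamiltonian G W U Λ η η

/-- The Boltzmann weight of the sites and edges that meet `Λ`, as a function on configurations. -/
noncomputable def gibbsWeight (Λ : Finset V) (η : V → ℝ) : ℝ≥0∞ :=
  ENNReal.ofReal (Real.exp (-energy G W U Λ η))

theorem boltzmann_eq (Λ : Finset V) (ξ : V → ℝ) (ω : Λ → ℝ) :
    boltzmann G W U Λ ξ ω = gibbsWeight G W U Λ (glue Λ ξ ω) := by
  unfold boltzmann gibbsWeight energy
  rw [hamiltonian_congr_boundary G W U (ξ := ξ) (ξ' := glue Λ ξ ω)]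
  exact fun x hx => (glue_of_notMem ξ ω hx).symm

theorem partition_eq (Λ : Finset V) (ξ : V → ℝ) :
    partition G W U Λ ξ = spinIntegral Λ (gibbsWeight G W U Λ) ξ := by
  simp only [partition, boltzmann_eq, spinIntegral]

variable {W U}

theorem continuous_energy (hW : Continuous fun z : ℝ × ℝ => W z.1 z.2) (hU : Continuous U)
    (Λ : Finset V) : Continuous (energy G W U Λ) := by
  have h : ∀ x y : V, Continuous fun η : V → ℝ => W (η x) (η y) := fun x y =>
    hW.comp (f := fun η : V → ℝ => (η x, η y)) (by fun_prop)
  unfold energy hamiltonian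
  fun_prop

theorem measurable_energy (hW : Continuous fun z : ℝ × ℝ => W z.1 z.2) (hU : Continuous U)
    (Λ : Finset V) : Measurable (energy G W U Λ) := by
  have h : ∀ x y : V, Measurable fun η : V → ℝ => W (η x) (η y) := fun x y =>
    hW.measurable.comp (f := fun η : V → ℝ => (η x, η y)) (by fun_prop)
  have hU := hU.measurable
  unfold energy hamiltonian
  fun_prop

theorem measurable_gibbsWeight (hW : Continuous fun z : ℝ × ℝ => W z.1 z.2) (hU : Continuous U)
    (Λ : Finset V) : Measurable (gibbsWeight G W U Λ) := by
  have := measurable_energy G hW hU Λ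
  unfold gibbsWeight
  fun_prop

theorem gibbsSpec_apply_eq (hW : Continuous fun z : ℝ × ℝ => W z.1 z.2) (hU : Continuous U)
    (Λ : Finset V) (ξ : V → ℝ) {f : (V → ℝ) → ℝ≥0∞} (hf : Measurable f) :
    ∫⁻ η, f η ∂gibbsSpec G W U Λ ξ =
      (partition G W U Λ ξ)⁻¹ * spinIntegral Λ (fun η => gibbsWeight G W U Λ η * f η) ξ := by
  have hg := measurable_glue_right Λ ξ
  have hb : Measurable (boltzmann G W U Λ ξ) := by
    rw [show boltzmann G W U Λ ξ = gibbsWeight G W U Λ ∘ glue Λ ξ from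
      funext (boltzmann_eq G W U Λ ξ)]
    exact (measurable_gibbsWeight G hW hU Λ).comp hg
  rw [gibbsSpec, lintegral_smul_measure, lintegral_map hf hg,
    lintegral_withDensity_eq_lintegral_mul _ hb (g := fun ω => f (glue Λ ξ ω)) (hf.comp hg)]
  simp only [spinIntegral, smul_eq_mul, Pi.mul_apply, boltzmann_eq]

theorem measurable_gibbsSpec (hW : Continuous fun z : ℝ × ℝ => W z.1 z.2) (hU : Continuous U)
    (Λ : Finset V) : Measurable (gibbsSpec G W U Λ) := by
  refine Measure.measurable_of_measurable_coe _ fun A hA => ?_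
  have h : ∀ ξ, gibbsSpec G W U Λ ξ A = (spinIntegral Λ (gibbsWeight G W U Λ) ξ)⁻¹ *
      spinIntegral Λ (fun η => gibbsWeight G W U Λ η * A.indicator 1 η) ξ := fun ξ => by
    rw [← partition_eq, ← gibbsSpec_apply_eq G hW hU Λ ξ (measurable_one.indicator hA),
      lintegral_indicator_one hA]
  simp only [h]
  have hw := measurable_gibbsWeight G hW hU Λ
  exact (measurable_spinIntegral Λ hw).inv.mul
    (measurable_spinIntegral Λ (hw.mul (measurable_one.indicator hA)))

theorem isProbabilityMeasure_gibbsSpec (hW : Continuous fun z : ℝ × ℝ => W z.1 z.2)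
    (hU : Continuous U) {Λ : Finset V} {ξ : V → ℝ} (h0 : partition G W U Λ ξ ≠ 0)
    (h1 : partition G W U Λ ξ ≠ ∞) : IsProbabilityMeasure (gibbsSpec G W U Λ ξ) := by
  constructor
  have := gibbsSpec_apply_eq G hW hU Λ ξ (f := fun _ => 1) measurable_const
  simp only [lintegral_const, one_mul, mul_one, ← partition_eq] at this
  rw [this, ENNReal.inv_mul_cancel h0 h1]

/-- The integral against the specification does not see changes of `f` off the boundary
condition. -/
theorem lintegral_gibbsSpec_congr (hW : Continuous fun z : ℝ × ℝ => W z.1 z.2) (hU : Continuous U)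
    {Λ : Finset V} {ξ : V → ℝ} {f g : (V → ℝ) → ℝ≥0∞} (hf : Measurable f) (hg : Measurable g)
    (h : ∀ η : V → ℝ, (∀ x ∉ Λ, η x = ξ x) → f η = g η) :
    ∫⁻ η, f η ∂gibbsSpec G W U Λ ξ = ∫⁻ η, g η ∂gibbsSpec G W U Λ ξ := by
  rw [gibbsSpec_apply_eq G hW hU Λ ξ hf, gibbsSpec_apply_eq G hW hU Λ ξ hg]
  congr 1
  exact spinIntegral_congr fun η hη => by rw [h η hη]

-- Both kinds of pair sums are moved to one square S × S, where the two variables can be exchanged.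
open Classical in
theorem sum_neighbor_filter_eq {Λ S : Finset V} (hΛ : Λ ⊆ S)
    (hS : ∀ x ∈ Λ, G.neighborFinset x ⊆ S) (P : V → Prop) (F : V → V → ℝ) :
    ∑ x ∈ Λ, ∑ y ∈ G.neighborFinset x with P y, F x y =
      ∑ x ∈ S, ∑ y ∈ S, if G.Adj x y ∧ x ∈ Λ ∧ P y then F x y else 0 := by
  rw [← Finset.sum_subset hΛ]
  · refine Finset.sum_congr rfl fun x hx => ?_
    rw [← Finset.sum_filter]
    refine Finset.sum_congr ?_ fun _ _ => rfl
    ext y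
    simp only [Finset.mem_filter, SimpleGraph.mem_neighborFinset]
    exact ⟨fun h => ⟨hS x hx (by simpa using h.1), h.1, hx, h.2⟩, fun h => ⟨h.2.1, h.2.2.2⟩⟩
  · intro x _ hx
    simp [hx]

open Classical in
/-- The energy as a symmetric sum over ordered pairs of sites. -/
theorem energy_eq (hWsymm : ∀ u v, W u v = W v u) {Λ S : Finset V} (hΛ : Λ ⊆ S)
    (hS : ∀ x ∈ Λ, G.neighborFinset x ⊆ S) (η : V → ℝ) :
    energy G W U Λ η = (1 / 2) * (∑ x ∈ S, ∑ y ∈ S,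
      if G.Adj x y ∧ (x ∈ Λ ∨ y ∈ Λ) then W (η x) (η y) else 0) + ∑ x ∈ Λ, U (η x) := by
  have h1 : ∑ x ∈ Λ, ∑ y ∈ G.neighborFinset x with y ∈ Λ, W (η x) (η y) =
      ∑ x ∈ S, ∑ y ∈ S, if G.Adj x y ∧ x ∈ Λ ∧ y ∈ Λ then W (η x) (η y) else 0 := by
    convert! sum_neighbor_filter_eq G hΛ hS (· ∈ Λ) fun x y => W (η x) (η y)
  have h2 : ∑ x ∈ Λ, ∑ y ∈ G.neighborFinset x with y ∉ Λ, W (η x) (η y) =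
      ∑ x ∈ S, ∑ y ∈ S, if G.Adj x y ∧ x ∈ Λ ∧ y ∉ Λ then W (η x) (η y) else 0 := by
    convert! sum_neighbor_filter_eq G hΛ hS (· ∉ Λ) fun x y => W (η x) (η y)
  have h3 : (∑ x ∈ S, ∑ y ∈ S, if G.Adj x y ∧ x ∈ Λ ∧ y ∉ Λ then W (η x) (η y) else 0) =
      ∑ x ∈ S, ∑ y ∈ S, if G.Adj x y ∧ x ∉ Λ ∧ y ∈ Λ then W (η x) (η y) else 0 := by
    rw [Finset.sum_comm]
    refine Finset.sum_congr rfl fun x _ => Finset.sum_congr rfl fun y _ => ?_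
    rw [hWsymm]
    simp only [G.adj_comm y x, and_comm]
  have h4 : (∑ x ∈ S, ∑ y ∈ S, if G.Adj x y ∧ (x ∈ Λ ∨ y ∈ Λ) then W (η x) (η y) else 0) =
      (∑ x ∈ S, ∑ y ∈ S, if G.Adj x y ∧ x ∈ Λ ∧ y ∈ Λ then W (η x) (η y) else 0) +
      (∑ x ∈ S, ∑ y ∈ S, if G.Adj x y ∧ x ∈ Λ ∧ y ∉ Λ then W (η x) (η y) else 0) +
      ∑ x ∈ S, ∑ y ∈ S, if G.Adj x y ∧ x ∉ Λ ∧ y ∈ Λ then W (η x) (η y) else 0 := by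
    simp only [← Finset.sum_add_distrib]
    refine Finset.sum_congr rfl fun x _ => Finset.sum_congr rfl fun y _ => ?_
    by_cases hx : x ∈ Λ <;> by_cases hy : y ∈ Λ <;> simp [hx, hy]
  unfold energy hamiltonian
  rw [h4, ← h3, h2, h1]
  ring

/-- Both energies contain each site and edge meeting Δ exactly once; these terms cancel, and no spin
of Δ is left in the difference. -/
theorem energy_sub_energy_congr (hWsymm : ∀ u v, W u v = W v u) {Δ Λ : Finset V} (hΔ : Δ ⊆ Λ)
    {η η' : V → ℝ} (h : ∀ x ∉ Δ, η x = η' x) :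
    energy G W U Λ η - energy G W U Δ η = energy G W U Λ η' - energy G W U Δ η' := by
  classical
  set S := Λ ∪ Λ.biUnion fun x => G.neighborFinset x with hSdef
  have hΛS : Λ ⊆ S := Finset.subset_union_left
  have hN : ∀ x ∈ Λ, G.neighborFinset x ⊆ S := fun x hx =>
    (Finset.subset_biUnion_of_mem (fun x => G.neighborFinset x) hx).trans
      Finset.subset_union_right
  have key : ∀ η : V → ℝ, energy G W U Λ η - energy G W U Δ η =
      (1 / 2) * (∑ x ∈ S, ∑ y ∈ S, if (G.Adj x y ∧ (x ∈ Λ ∨ y ∈ Λ)) ∧ x ∉ Δ ∧ y ∉ Δ then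
        W (η x) (η y) else 0) + ∑ x ∈ Λ \ Δ, U (η x) := fun η => by
    rw [energy_eq G hWsymm hΛS hN, energy_eq G hWsymm (hΔ.trans hΛS) fun x hx => hN x (hΔ hx),
      ← Finset.sum_sdiff hΔ (f := fun x => U (η x))]
    have : (∑ x ∈ S, ∑ y ∈ S, if G.Adj x y ∧ (x ∈ Λ ∨ y ∈ Λ) then W (η x) (η y) else 0) =
        (∑ x ∈ S, ∑ y ∈ S, if (G.Adj x y ∧ (x ∈ Λ ∨ y ∈ Λ)) ∧ x ∉ Δ ∧ y ∉ Δ then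
          W (η x) (η y) else 0) +
        ∑ x ∈ S, ∑ y ∈ S, if G.Adj x y ∧ (x ∈ Δ ∨ y ∈ Δ) then W (η x) (η y) else 0 := by
      simp only [← Finset.sum_add_distrib]
      refine Finset.sum_congr rfl fun x _ => Finset.sum_congr rfl fun y _ => ?_
      have hx := @hΔ x
      have hy := @hΔ y
      by_cases h1 : x ∈ Δ <;> by_cases h2 : y ∈ Δ <;> simp [h1, h2, hx, hy]
    rw [this]
    ring
  rw [key, key]
  congr 1
  · congr 1
    refine Finset.sum_congr rfl fun x _ => Finset.sum_congr rfl fun y _ => ?_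
    split_ifs with hc
    · rw [h x hc.2.1, h y hc.2.2]
    · rfl
  · exact Finset.sum_congr rfl fun x hx => by rw [h x (Finset.mem_sdiff.1 hx).2]

/-- Consistency of the local Gibbs specification. -/
theorem lintegral_lintegral_gibbsSpec (hW : Continuous fun z : ℝ × ℝ => W z.1 z.2)
    (hWsymm : ∀ u v, W u v = W v u) (hU : Continuous U)
    (hZ : ∀ (Λ : Finset V) (ξ : V → ℝ), partition G W U Λ ξ ≠ 0 ∧ partition G W U Λ ξ ≠ ∞)
    {Δ Λ : Finset V} (hΔ : Δ ⊆ Λ) (ξ : V → ℝ) {f : (V → ℝ) → ℝ≥0∞} (hf : Measurable f) :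
    ∫⁻ η, ∫⁻ ζ, f ζ ∂gibbsSpec G W U Δ η ∂gibbsSpec G W U Λ ξ =
      ∫⁻ η, f η ∂gibbsSpec G W U Λ ξ := by
  classical
  have hwΔ := measurable_gibbsWeight G hW hU Δ
  have hwΛ := measurable_gibbsWeight G hW hU Λ
  -- `R` is the Boltzmann weight of the terms that meet Λ but not Δ, so it passes through the
  -- integral over the spins in Δ.
  set R : (V → ℝ) → ℝ≥0∞ := fun η =>
    ENNReal.ofReal (Real.exp (-(energy G W U Λ η - energy G W U Δ η))) with hR
  have hRm : Measurable R := by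
    have h1 := measurable_energy G hW hU Δ
    have h2 := measurable_energy G hW hU Λ
    fun_prop
  have hRc : ∀ η η' : V → ℝ, (∀ x ∉ Δ, η x = η' x) → R η = R η' := fun η η' h => by
    simp only [hR, energy_sub_energy_congr G hWsymm hΔ h]
  have hfac : ∀ η, gibbsWeight G W U Λ η = R η * gibbsWeight G W U Δ η := fun η => by
    simp only [hR, gibbsWeight]
    rw [← ENNReal.ofReal_mul (Real.exp_pos _).le, ← Real.exp_add]
    ring_nf
  have hm : Measurable fun η => ∫⁻ ζ, f ζ ∂gibbsSpec G W U Δ η :=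
    (Measure.measurable_lintegral hf).comp (measurable_gibbsSpec G hW hU Δ)
  rw [gibbsSpec_apply_eq G hW hU Λ ξ hm, gibbsSpec_apply_eq G hW hU Λ ξ hf,
    spinIntegral_sdiff hΔ (f := fun η => gibbsWeight G W U Λ η * _) (hwΛ.mul hm),
    spinIntegral_sdiff hΔ (f := fun η => gibbsWeight G W U Λ η * f η) (hwΛ.mul hf)]
  congr 1
  refine spinIntegral_congr fun η _ => ?_
  have h1 : spinIntegral Δ (fun η => gibbsWeight G W U Λ η * f η) η =
      R η * spinIntegral Δ (fun η => gibbsWeight G W U Δ η * f η) η := by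
    rw [← spinIntegral_mul_left (f := fun η => gibbsWeight G W U Δ η * f η) (hwΔ.mul hf)
      fun η' h => hRc η' η h]
    exact spinIntegral_congr fun η' _ => by rw [hfac]; ring
  -- The inner expectation also depends only on spins off Δ; what is integrated over Δ is then just
  -- Z_Δ, which cancels its normalization.
  have h2 : spinIntegral Δ (fun η => gibbsWeight G W U Λ η *
      ∫⁻ ζ, f ζ ∂gibbsSpec G W U Δ η) η =
      (R η * ∫⁻ ζ, f ζ ∂gibbsSpec G W U Δ η) * partition G W U Δ η := by
    rw [partition_eq, ← spinIntegral_mul_left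
      (g := fun η => R η * ∫⁻ ζ, f ζ ∂gibbsSpec G W U Δ η) hwΔ]
    · exact spinIntegral_congr fun η' _ => by rw [hfac]; ring
    · intro η' h
      simp only [hRc η' η h, gibbsSpec_apply_eq G hW hU Δ _ hf, partition_eq,
        spinIntegral_congr_boundary _ h]
  rw [h1, h2, gibbsSpec_apply_eq G hW hU Δ η hf, mul_assoc, mul_comm _ (partition G W U Δ η),
    ← mul_assoc (partition G W U Δ η), ENNReal.mul_inv_cancel (hZ Δ η).1 (hZ Δ η).2, one_mul]

theorem bind_gibbsSpec_of_mem (hW : Continuous fun z : ℝ × ℝ => W z.1 z.2) (hU : Continuous U)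
    {μ : ProbabilityMeasure (V → ℝ)} :
    μ ∈ gibbsMeasures G W U ↔ ∀ Λ : Finset V, Λ.Nonempty →
      (μ : Measure (V → ℝ)).bind (gibbsSpec G W U Λ) = μ := by
  refine forall₂_congr fun Λ _ => ?_
  have hm := measurable_gibbsSpec G hW hU Λ
  constructor
  · intro h
    ext A hA
    rw [h A hA, Measure.bind_apply hA hm.aemeasurable]
  · intro h A hA
    rw [← Measure.bind_apply hA hm.aemeasurable, h]

theorem lintegral_lintegral_gibbsSpec_of_mem (hW : Continuous fun z : ℝ × ℝ => W z.1 z.2)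
    (hU : Continuous U) {μ : ProbabilityMeasure (V → ℝ)} (hμ : μ ∈ gibbsMeasures G W U)
    {Λ : Finset V} (hΛ : Λ.Nonempty) {f : (V → ℝ) → ℝ≥0∞} (hf : Measurable f) :
    ∫⁻ ξ, ∫⁻ η, f η ∂gibbsSpec G W U Λ ξ ∂(μ : Measure (V → ℝ)) = ∫⁻ η, f η ∂(μ : Measure _) := by
  conv_rhs => rw [← (bind_gibbsSpec_of_mem G hW hU).1 hμ Λ hΛ]
  rw [Measure.lintegral_bind (measurable_gibbsSpec G hW hU Λ).aemeasurable hf.aemeasurable]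

end

/-! ### Stability of the energy, finiteness of the partition function and the Feller property. -/

section

variable {V : Type*}

/-- The standing assumptions on the pair potential `W` and the self-interaction `U`. -/
structure IsStablePotential (W : ℝ → ℝ → ℝ) (U : ℝ → ℝ) (r q I J a c : ℝ) : Prop where
  continuous_pair : Continuous fun z : ℝ × ℝ => W z.1 z.2
  symm : ∀ u v, W u v = W v u
  r_pos : 0 < r
  I_pos : 0 < I
  J_pos : 0 < J
  abs_pair_le : ∀ u v, |W u v| ≤ (I + J * (|u| ^ r + |v| ^ r)) / 2
  continuous_self : Continuous U
  a_pos : 0 < a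
  self_ge : ∀ u, a * |u| ^ q - c ≤ U u

variable (G : SimpleGraph V) [G.LocallyFinite] {W : ℝ → ℝ → ℝ} {U : ℝ → ℝ} {r q I J a c p : ℝ}

-- Inner edges, counted as ordered pairs, carry a factor 1/2. Dropping it from their non-negative
-- upper bound lets all neighbours be treated alike.
open Classical in
theorem neg_energy_le (hP : IsStablePotential W U r q I J a c) (Λ : Finset V) (η : V → ℝ) :
    -energy G W U Λ η ≤ (∑ x ∈ Λ, ∑ y ∈ G.neighborFinset x,
      (I + J * (|η x| ^ r + |η y| ^ r)) / 2) - ∑ x ∈ Λ, U (η x) := by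
  have h : ∀ x, -(∑ y ∈ G.neighborFinset x, (I + J * (|η x| ^ r + |η y| ^ r)) / 2) ≤
      1 / 2 * (∑ y ∈ G.neighborFinset x with y ∈ Λ, W (η x) (η y)) +
        ∑ y ∈ G.neighborFinset x with y ∉ Λ, W (η x) (η y) := fun x => by
    rw [← Finset.sum_filter_add_sum_filter_not (G.neighborFinset x) (· ∈ Λ), neg_add,
      ← Finset.sum_neg_distrib, ← Finset.sum_neg_distrib, Finset.mul_sum]
    refine add_le_add (Finset.sum_le_sum fun y _ => ?_) (Finset.sum_le_sum fun y _ => ?_)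
    · have h1 := hP.abs_pair_le (η x) (η y)
      have h2 := abs_nonneg (W (η x) (η y))
      have h3 := neg_abs_le (W (η x) (η y))
      linarith
    · have h1 := hP.abs_pair_le (η x) (η y)
      have h3 := neg_abs_le (W (η x) (η y))
      linarith
  have h2 := Finset.sum_le_sum fun x (_ : x ∈ Λ) => h x
  rw [Finset.sum_neg_distrib, Finset.sum_add_distrib, ← Finset.mul_sum] at h2
  unfold energy hamiltonian
  linarith

/-- The slack 1 in the boundary spins makes the constants valid on a whole neighbourhood of ξ, as
continuity in the boundary condition requires. -/
theorem exists_neg_energy_le (hP : IsStablePotential W U r q I J a c) (hrp : r ≤ p)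
    (Λ : Finset V) (ξ : V → ℝ) : ∃ K L : ℝ, 0 ≤ L ∧ ∀ η : V → ℝ,
      (∀ x ∈ Λ, ∀ y ∈ G.neighborFinset x, y ∉ Λ → |η y| ≤ |ξ y| + 1) →
      -energy G W U Λ η ≤ K + ∑ x ∈ Λ, (L * |η x| ^ p - U (η x)) := by
  have hJ := hP.J_pos
  have hr := hP.r_pos
  -- Inside Λ each |η(z)|^r is at most |Λ| + S, so every pair costs J S plus a constant.
  refine ⟨(∑ x ∈ Λ, ∑ y ∈ G.neighborFinset x, (I + J * (|ξ y| + 1) ^ r + 2 * J * Λ.card) / 2),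
    ∑ x ∈ Λ, ∑ y ∈ G.neighborFinset x, J, by positivity, fun η hη => ?_⟩
  set S := ∑ z ∈ Λ, |η z| ^ p with hS
  have hmem : ∀ z ∈ Λ, |η z| ^ r ≤ Λ.card + S := fun z hz => by
    refine (rpow_le_one_add_rpow hr.le hrp (abs_nonneg _)).trans (add_le_add ?_ ?_)
    · exact_mod_cast Finset.card_pos.2 ⟨z, hz⟩
    · exact Finset.single_le_sum (f := fun z => |η z| ^ p) (fun _ _ => by positivity) hz
  have hS0 : 0 ≤ S := by positivity
  refine (neg_energy_le G hP Λ η).trans ?_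
  rw [Finset.sum_sub_distrib, ← Finset.mul_sum, ← hS, Finset.sum_mul, ← add_sub_assoc,
    ← Finset.sum_add_distrib]
  gcongr with x hx
  rw [Finset.sum_mul, ← Finset.sum_add_distrib]
  refine Finset.sum_le_sum fun y hy => ?_
  have h1 := hmem x hx
  have h2 : |η y| ^ r ≤ (|ξ y| + 1) ^ r + (Λ.card + S) := by
    by_cases hyΛ : y ∈ Λ
    · have := hmem y hyΛ
      have : 0 ≤ (|ξ y| + 1) ^ r := by positivity
      linarith
    · have := Real.rpow_le_rpow (abs_nonneg _) (hη x hx y hy hyΛ) hr.le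
      have : (0 : ℝ) ≤ Λ.card + S := by positivity
      linarith
  nlinarith

/-- An integrable function of `ω_Λ` that dominates Boltzmann weights locally uniformly in the
boundary condition, even after multiplication by `exp (λ ∑ |ω(x)|^p)`. -/
theorem exists_dominating (hP : IsStablePotential W U r q I J a c) (hrp : r ≤ p) (hpq : p < q)
    (Λ : Finset V) (ξ : V → ℝ) {lam : ℝ} (hlam : 0 ≤ lam) :
    ∃ B : (Λ → ℝ) → ℝ≥0∞, ∫⁻ ω, B ω ≠ ∞ ∧ ∀ (ξ' : V → ℝ) (ω : Λ → ℝ),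
      (∀ x ∈ Λ, ∀ y ∈ G.neighborFinset x, y ∉ Λ → |ξ' y| ≤ |ξ y| + 1) →
      gibbsWeight G W U Λ (glue Λ ξ' ω) *
        ENNReal.ofReal (Real.exp (lam * ∑ x ∈ Λ, |glue Λ ξ' ω x| ^ p)) ≤ B ω := by
  obtain ⟨K, L, hL, hK⟩ := exists_neg_energy_le G hP hrp Λ ξ
  have hp : 0 < p := hP.r_pos.trans_le hrp
  have hint : Integrable (fun ω : Λ → ℝ =>
      Real.exp K * ∏ x, Real.exp ((L + lam) * |ω x| ^ p - U (ω x))) :=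
    (Integrable.fintype_prod fun _ => integrable_exp_mul_rpow_sub hP.continuous_self hP.a_pos
      hP.self_ge hp hpq (by positivity)).const_mul _
  refine ⟨fun ω => ENNReal.ofReal (Real.exp K *
    ∏ x, Real.exp ((L + lam) * |ω x| ^ p - U (ω x))), hint.lintegral_lt_top.ne, ?_⟩
  intro ξ' ω h
  beta_reduce
  rw [gibbsWeight, ← ENNReal.ofReal_mul (Real.exp_pos _).le, ← Real.exp_add, ← Real.exp_sum,
    ← Real.exp_add]
  refine ENNReal.ofReal_le_ofReal (Real.exp_le_exp.2 ?_)
  have h1 := hK (glue Λ ξ' ω) fun x hx y hy hyΛ => by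
    rw [glue_of_notMem _ _ hyΛ]; exact h x hx y hy hyΛ
  have h2 : ∑ x : Λ, ((L + lam) * |ω x| ^ p - U (ω x)) =
      ∑ x ∈ Λ, ((L + lam) * |glue Λ ξ' ω x| ^ p - U (glue Λ ξ' ω x)) := by
    rw [← Finset.sum_coe_sort Λ]
    exact Finset.sum_congr rfl fun x _ => by rw [glue_of_mem _ _ x.2]
  rw [h2]
  have h3 : ∑ x ∈ Λ, ((L + lam) * |glue Λ ξ' ω x| ^ p - U (glue Λ ξ' ω x)) =
      ∑ x ∈ Λ, (L * |glue Λ ξ' ω x| ^ p - U (glue Λ ξ' ω x)) +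
        lam * ∑ x ∈ Λ, |glue Λ ξ' ω x| ^ p := by
    rw [Finset.mul_sum, ← Finset.sum_add_distrib]
    exact Finset.sum_congr rfl fun x _ => by ring
  linarith

theorem spinIntegral_exp_ne_top (hP : IsStablePotential W U r q I J a c) (hrp : r ≤ p)
    (hpq : p < q) (Λ : Finset V) (ξ : V → ℝ) {lam : ℝ} (hlam : 0 ≤ lam) :
    spinIntegral Λ (fun η => gibbsWeight G W U Λ η *
      ENNReal.ofReal (Real.exp (lam * ∑ x ∈ Λ, |η x| ^ p))) ξ ≠ ∞ := by
  obtain ⟨B, hB, h⟩ := exists_dominating G hP hrp hpq Λ ξ hlam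
  exact ne_top_of_le_ne_top hB
    (lintegral_mono fun ω => h ξ ω fun _ _ _ _ _ => by linarith)

theorem partition_ne_top (hP : IsStablePotential W U r q I J a c) (hrp : r ≤ p)
    (hpq : p < q) (Λ : Finset V) (ξ : V → ℝ) : partition G W U Λ ξ ≠ ∞ := by
  have := spinIntegral_exp_ne_top G hP hrp hpq Λ ξ le_rfl
  simpa [partition_eq] using this

theorem partition_ne_zero (hP : IsStablePotential W U r q I J a c) (Λ : Finset V) (ξ : V → ℝ) :
    partition G W U Λ ξ ≠ 0 := by
  have hm : Measurable fun ω => gibbsWeight G W U Λ (glue Λ ξ ω) :=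
    (measurable_gibbsWeight G hP.continuous_pair hP.continuous_self Λ).comp
      (measurable_glue_right Λ ξ)
  rw [partition_eq, spinIntegral]
  intro h
  rw [lintegral_eq_zero_iff hm] at h
  obtain ⟨ω, hω⟩ := h.exists
  simp [gibbsWeight] at hω
  exact absurd hω (not_le.2 (Real.exp_pos _))

variable [Countable V]

/-- Dominated convergence applies: only finitely many boundary spins interact with Λ, so the
domination holds on a neighbourhood in the product topology. -/
theorem continuous_spinIntegral (hP : IsStablePotential W U r q I J a c) (hrp : r ≤ p)
    (hpq : p < q) (Λ : Finset V) {f : (V → ℝ) → ℝ≥0∞} (hf : Continuous f) {M : ℝ≥0∞}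
    (hM : M ≠ ∞) (hfM : ∀ η, f η ≤ M) :
    Continuous (spinIntegral Λ fun η => gibbsWeight G W U Λ η * f η) := by
  have hw := measurable_gibbsWeight G hP.continuous_pair hP.continuous_self Λ
  have hwc : Continuous (gibbsWeight G W U Λ) := ENNReal.continuous_ofReal.comp
    (Real.continuous_exp.comp
      (continuous_energy G hP.continuous_pair hP.continuous_self Λ).neg)
  refine continuous_iff_continuousAt.2 fun ξ => ?_
  obtain ⟨B, hB, h⟩ := exists_dominating G hP hrp hpq Λ ξ le_rfl
  refine tendsto_lintegral_filter_of_dominated_convergence (fun ω => M * B ω) ?_ ?_ ?_ ?_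
  · exact Filter.Eventually.of_forall fun ξ' =>
      (hw.mul hf.measurable).comp (measurable_glue_right Λ ξ')
  · have hev : ∀ᶠ ξ' in nhds ξ, ∀ x ∈ Λ, ∀ y ∈ G.neighborFinset x, |ξ' y| ≤ |ξ y| + 1 := by
      simp only [Filter.eventually_all_finset]
      intro x _ y _
      have hc : Continuous fun ξ' : V → ℝ => |ξ' y| := by fun_prop
      exact (hc.tendsto ξ).eventually (ge_mem_nhds (lt_add_one _)) 
    filter_upwards [hev] with ξ' hξ'
    refine Filter.Eventually.of_forall fun ω => ?_
    have := h ξ' ω fun x hx y hy _ => hξ' x hx y hy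
    simp only [zero_mul, Real.exp_zero, ENNReal.ofReal_one, mul_one] at this
    rw [mul_comm]
    exact mul_le_mul' (hfM _) this
  · rw [lintegral_const_mul' _ _ hM]
    exact ENNReal.mul_ne_top hM hB
  · refine Filter.Eventually.of_forall fun ω => ?_
    have hg : Filter.Tendsto (fun ξ' => glue Λ ξ' ω) (nhds ξ) (nhds (glue Λ ξ ω)) :=
      ((continuous_glue Λ).comp (Continuous.prodMk_left ω)).tendsto ξ
    exact ENNReal.Tendsto.mul ((hwc.tendsto _).comp hg)
      (Or.inr (ne_top_of_le_ne_top hM (hfM _))) ((hf.tendsto _).comp hg)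
      (Or.inr ENNReal.ofReal_ne_top)

/-- The Feller property of the local Gibbs specification. -/
theorem continuous_lintegral_gibbsSpec (hP : IsStablePotential W U r q I J a c) (hrp : r ≤ p)
    (hpq : p < q) (Λ : Finset V) {f : (V → ℝ) → ℝ≥0∞} (hf : Continuous f) {M : ℝ≥0∞}
    (hM : M ≠ ∞) (hfM : ∀ η, f η ≤ M) :
    Continuous fun ξ => ∫⁻ η, f η ∂gibbsSpec G W U Λ ξ := by
  have h1 := continuous_spinIntegral G hP hrp hpq Λ hf hM hfM
  have h2 : Continuous (partition G W U Λ) := by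
    have := continuous_spinIntegral G hP hrp hpq Λ (f := fun _ => 1) continuous_const
      ENNReal.one_ne_top fun _ => le_rfl
    simp only [mul_one] at this
    exact this.congr fun ξ => (partition_eq G W U Λ ξ).symm
  have hZ := partition_ne_zero G hP Λ
  simp only [gibbsSpec_apply_eq G hP.continuous_pair hP.continuous_self Λ _ hf.measurable]
  refine continuous_iff_continuousAt.2 fun ξ => ?_
  refine ENNReal.Tendsto.mul ((continuous_inv.tendsto _).comp (h2.tendsto ξ)) (Or.inr ?_)
    (h1.tendsto ξ) (Or.inr (ENNReal.inv_ne_top.2 (hZ ξ)))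
  have hw := measurable_gibbsWeight G hP.continuous_pair hP.continuous_self Λ
  -- Multiplication on [0,∞] is discontinuous at (0,∞), so the numerator has to be shown finite.
  have hle : spinIntegral Λ (fun η => gibbsWeight G W U Λ η * f η) ξ ≤
      M * spinIntegral Λ (gibbsWeight G W U Λ) ξ := by
    rw [← spinIntegral_mul_left (g := fun _ => M) hw fun _ _ => rfl]
    exact spinIntegral_mono fun η _ => by rw [mul_comm]; exact mul_le_mul' (hfM η) le_rfl
  refine ne_top_of_le_ne_top (ENNReal.mul_ne_top hM ?_) hle
  rw [← partition_eq]
  exact partition_ne_top G hP hrp hpq Λ ξ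

end

/-! ### Exponential moment estimates in finite volumes. -/

section

theorem ofReal_exp_sum {ι : Type*} (s : Finset ι) (t b : ι → ℝ) :
    ENNReal.ofReal (Real.exp (∑ i ∈ s, t i * b i)) =
      ∏ i ∈ s, ENNReal.ofReal (Real.exp (b i)) ^ t i := by
  rw [Real.exp_sum, ENNReal.ofReal_prod_of_nonneg fun _ _ => (Real.exp_pos _).le]
  refine Finset.prod_congr rfl fun i _ => ?_
  rw [ENNReal.ofReal_rpow_of_pos (Real.exp_pos _), ← Real.exp_mul, mul_comm]

/-- Hölder's inequality for exponential moments. -/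
theorem lintegral_exp_sum_le {Ω ι : Type*} [MeasurableSpace Ω] (μ : Measure Ω)
    [IsProbabilityMeasure μ] (s : Finset ι) {t : ι → ℝ} (ht : ∀ i ∈ s, 0 ≤ t i)
    (ht1 : ∑ i ∈ s, t i ≤ 1) {h : ι → Ω → ℝ} (hh : ∀ i, Measurable (h i)) {b : ι → ℝ}
    (hb : ∀ i ∈ s, ∫⁻ ω, ENNReal.ofReal (Real.exp (h i ω)) ∂μ ≤ ENNReal.ofReal (Real.exp (b i))) :
    ∫⁻ ω, ENNReal.ofReal (Real.exp (∑ i ∈ s, t i * h i ω)) ∂μ ≤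
      ENNReal.ofReal (Real.exp (∑ i ∈ s, t i * b i)) := by
  -- The missing exponent 1 - ∑ t is given to the constant function 1.
  have := ENNReal.lintegral_mul_prod_norm_pow_le (μ := μ) s (g := fun _ => 1)
    (f := fun i ω => ENNReal.ofReal (Real.exp (h i ω))) aemeasurable_const
    (fun i _ => by have := hh i; fun_prop) (1 - ∑ i ∈ s, t i) (p := t) (by ring)
    (by linarith) ht
  simp only [ENNReal.one_rpow, one_mul, lintegral_const, measure_univ, mul_one] at this
  simp only [ofReal_exp_sum]
  exact this.trans (Finset.prod_le_prod' fun i hi => ENNReal.rpow_le_rpow (hb i hi) (ht i hi))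

theorem weight_le_exp_mul_weight {V : Type*} (G : SimpleGraph V) (hG : G.Connected) (o : V) {α : ℝ} (hα : 0 ≤ α) {x y : V}
    (h : G.Adj x y) : weight G o α x ≤ Real.exp α * weight G o α y := by
  unfold weight
  rw [← Real.exp_add, Real.exp_le_exp]
  have h1 : G.dist o y ≤ G.dist o x + G.dist x y := hG.dist_triangle
  rw [SimpleGraph.dist_eq_one_iff_adj.2 h] at h1
  have h2 : (G.dist o y : ℝ) ≤ G.dist o x + 1 := by exact_mod_cast h1
  nlinarith

variable {V : Type*} (G : SimpleGraph V) [G.LocallyFinite]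

theorem one_le_degree {x y : V} (h : G.Adj x y) : (1 : ℝ) ≤ G.degree x := by
  exact_mod_cast (G.degree_pos_iff_exists_adj x).2 ⟨y, h⟩

theorem one_le_degree_mul_degree {x y : V} (h : G.Adj x y) :
    (1 : ℝ) ≤ (G.degree x : ℝ) * G.degree y :=
  one_le_mul_of_one_le_of_one_le (one_le_degree G h) (one_le_degree G h.symm)

/-- There are n(x) terms, each at most 1/n(x) because n(y) ≥ 1. -/
theorem sum_inv_degree_mul_degree_le (x : V) :
    ∑ y ∈ G.neighborFinset x, ((G.degree x : ℝ) * G.degree y)⁻¹ ≤ 1 := by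
  calc ∑ y ∈ G.neighborFinset x, ((G.degree x : ℝ) * G.degree y)⁻¹
      ≤ ∑ y ∈ G.neighborFinset x, (G.degree x : ℝ)⁻¹ := by
        refine Finset.sum_le_sum fun y hy => ?_
        rw [SimpleGraph.mem_neighborFinset] at hy
        have h1 := one_le_degree G hy
        have h2 := one_le_degree G hy.symm
        exact inv_anti₀ (by linarith) (le_mul_of_one_le_right (by linarith) h2)
    _ = (G.degree x : ℝ) * (G.degree x : ℝ)⁻¹ := by
        rw [Finset.sum_const, SimpleGraph.card_neighborFinset_eq_degree, nsmul_eq_mul]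
    _ ≤ 1 := mul_inv_le_one

variable {W : ℝ → ℝ → ℝ} {U : ℝ → ℝ} {r q I J a c p θ : ℝ}

open Classical in
theorem energy_singleton (x : V) (ξ : V → ℝ) (u : ℝ) :
    energy G W U {x} (Function.update ξ x u) =
      ∑ y ∈ G.neighborFinset x, W u (ξ y) + U u := by
  have h : ∀ y ∈ G.neighborFinset x, y ≠ x := fun y hy => by
    rw [SimpleGraph.mem_neighborFinset] at hy
    exact hy.ne'
  unfold energy hamiltonian
  rw [Finset.sum_singleton, Finset.sum_singleton, Finset.sum_singleton,
    Finset.filter_false_of_mem fun y hy => by simpa using h y hy,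
    Finset.filter_true_of_mem fun y hy => by simpa using h y hy]
  simp only [Finset.sum_empty, mul_zero, zero_add, Function.update_self]
  congr 1
  exact Finset.sum_congr rfl fun y hy => by rw [Function.update_of_ne (h y hy)]

/-- The weighted influence `∑_{y ∼ x} h(y) / (n(x) n(y))` of the neighbours of `x`. -/
noncomputable def neighborMean (h : V → ℝ) (x : V) : ℝ :=
  ∑ y ∈ G.neighborFinset x, h y / ((G.degree x : ℝ) * G.degree y)

/-- `rpow_le_mul_rpow_div_add` is used for both spins with ε/J and N = n(x)n(y). The terms N^θ sum
to `degreeSum`, and the factors 1/N in front of |u|^p sum to at most 1. -/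
theorem abs_sum_pair_le (hP : IsStablePotential W U r q I J a c) (hθ : 0 < θ)
    (hp : r + r / θ ≤ p) {ε : ℝ} (hε : 0 < ε) (x : V) (ξ : V → ℝ) (u : ℝ) :
    |∑ y ∈ G.neighborFinset x, W u (ξ y)| ≤ ε / 2 * |u| ^ p +
      ((I / 2 + J * (max 1 (ε / J)⁻¹) ^ θ) * degreeSum G θ x +
        ε / 2 * neighborMean G (fun y => |ξ y| ^ p) x) := by
  have hJ := hP.J_pos
  have hI := hP.I_pos
  set K := (max 1 (ε / J)⁻¹) ^ θ with hK
  have hterm : ∀ y ∈ G.neighborFinset x, |W u (ξ y)| ≤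
      ε / 2 * |u| ^ p * ((G.degree x : ℝ) * G.degree y)⁻¹ +
      ((I / 2 + J * K) * ((G.degree x : ℝ) * G.degree y) ^ θ +
        ε / 2 * (|ξ y| ^ p / ((G.degree x : ℝ) * G.degree y))) := fun y hy => by
    rw [SimpleGraph.mem_neighborFinset] at hy
    have hN := one_le_degree_mul_degree G hy
    have h1 := rpow_le_mul_rpow_div_add hP.r_pos hθ hp (div_pos hε hJ) hN (abs_nonneg u)
    have h2 := rpow_le_mul_rpow_div_add hP.r_pos hθ hp (div_pos hε hJ) hN (abs_nonneg (ξ y))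
    rw [← hK] at h1 h2
    have h3 := hP.abs_pair_le u (ξ y)
    have h4 := Real.one_le_rpow hN hθ.le
    set N := (G.degree x : ℝ) * G.degree y
    have h5 := mul_le_mul_of_nonneg_left h1 hJ.le
    have h6 := mul_le_mul_of_nonneg_left h2 hJ.le
    have e1 : J * (ε / J * (|u| ^ p / N) + K * N ^ θ) = ε * (|u| ^ p / N) + J * K * N ^ θ := by
      field_simp
    have e2 : J * (ε / J * (|ξ y| ^ p / N) + K * N ^ θ) =
        ε * (|ξ y| ^ p / N) + J * K * N ^ θ := by
      field_simp
    rw [e1] at h5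
    rw [e2] at h6
    rw [div_eq_mul_inv (|u| ^ p)] at h5
    nlinarith
  refine (Finset.abs_sum_le_sum_abs _ _).trans ((Finset.sum_le_sum hterm).trans ?_)
  rw [Finset.sum_add_distrib, Finset.sum_add_distrib, ← Finset.mul_sum, ← Finset.mul_sum,
    ← Finset.mul_sum]
  refine add_le_add ?_ le_rfl
  exact mul_le_of_le_one_right (by positivity) (sum_inv_degree_mul_degree_le G x)

/-- The one-site exponential moment estimate. -/
theorem exists_one_site_bound (hP : IsStablePotential W U r q I J a c) (hθ : 0 < θ)
    (hp : r + r / θ ≤ p) (hpq : p < q) {lam ε : ℝ} (hlam : 0 ≤ lam) (hε : 0 < ε) :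
    ∃ C₁ C₂ : ℝ, 0 ≤ C₁ ∧ 0 ≤ C₂ ∧ ∀ (x : V) (ξ : V → ℝ),
      ∫⁻ η, ENNReal.ofReal (Real.exp (lam * |η x| ^ p)) ∂gibbsSpec G W U {x} ξ ≤
        ENNReal.ofReal (Real.exp (C₁ + C₂ * degreeSum G θ x +
          ε * neighborMean G (fun y => |ξ y| ^ p) x)) := by
  classical
  have hp0 : 0 < p := lt_of_lt_of_le (add_pos hP.r_pos (div_pos hP.r_pos hθ)) hp
  have hJ := hP.J_pos
  have hI := hP.I_pos
  have hiA := integrable_exp_mul_rpow_sub hP.continuous_self hP.a_pos hP.self_ge hp0 hpq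
    (L := lam + ε / 2) (by positivity)
  have hiB : Integrable fun u : ℝ => Real.exp (-(ε / 2 * |u| ^ p) - U u) := by
    refine hiA.mono' ?_ (Filter.Eventually.of_forall fun u => ?_)
    · exact (Real.continuous_exp.comp (((continuous_const).mul
        (continuous_abs.rpow_const fun _ => Or.inr hp0.le)).neg.sub
          hP.continuous_self)).aestronglyMeasurable
    · rw [Real.norm_of_nonneg (Real.exp_pos _).le]
      refine Real.exp_le_exp.2 ?_
      have : 0 ≤ |u| ^ p := by positivity
      nlinarith
  set A := ∫ u : ℝ, Real.exp ((lam + ε / 2) * |u| ^ p - U u) with hA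
  set B := ∫ u : ℝ, Real.exp (-(ε / 2 * |u| ^ p) - U u) with hB
  have hA0 : 0 < A := integral_exp_pos hiA
  have hB0 : 0 < B := integral_exp_pos hiB
  set c₀ := I / 2 + J * (max 1 (ε / J)⁻¹) ^ θ with hc₀
  refine ⟨|Real.log (A / B)|, 2 * c₀, abs_nonneg _, by positivity, fun x ξ => ?_⟩
  -- The numerator is at most e^D A and the partition function at least e^(-D) B. The final exponent
  -- therefore contains 2D, whence ε/2 here and the constant 2c₀.
  set D := c₀ * degreeSum G θ x + ε / 2 * neighborMean G (fun y => |ξ y| ^ p) x with hD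
  have hE : ∀ u, |energy G W U {x} (Function.update ξ x u) - U u| ≤ ε / 2 * |u| ^ p + D :=
    fun u => by
      rw [energy_singleton, add_sub_cancel_right]
      exact abs_sum_pair_le G hP hθ hp hε x ξ u
  have hm : Measurable fun η : V → ℝ => ENNReal.ofReal (Real.exp (lam * |η x| ^ p)) := by
    fun_prop
  have hnum : spinIntegral {x} (fun η => gibbsWeight G W U {x} η *
      ENNReal.ofReal (Real.exp (lam * |η x| ^ p))) ξ ≤ ENNReal.ofReal (Real.exp D * A) := by
    rw [spinIntegral_singleton, hA, ← integral_const_mul,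
      ofReal_integral_eq_lintegral_ofReal (hiA.const_mul _)
        (Filter.Eventually.of_forall fun u => by positivity)]
    refine lintegral_mono fun u => ?_
    rw [gibbsWeight, ← ENNReal.ofReal_mul (Real.exp_pos _).le, ← Real.exp_add, ← Real.exp_add,
      Function.update_self]
    refine ENNReal.ofReal_le_ofReal (Real.exp_le_exp.2 ?_)
    have := (abs_le.1 (hE u)).1
    linarith
  have hden : ENNReal.ofReal (Real.exp (-D) * B) ≤ partition G W U {x} ξ := by
    rw [partition_eq, spinIntegral_singleton, hB, ← integral_const_mul,
      ofReal_integral_eq_lintegral_ofReal (hiB.const_mul _)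
        (Filter.Eventually.of_forall fun u => by positivity)]
    refine lintegral_mono fun u => ?_
    rw [gibbsWeight, ← Real.exp_add]
    refine ENNReal.ofReal_le_ofReal (Real.exp_le_exp.2 ?_)
    have := (abs_le.1 (hE u)).2
    linarith
  rw [gibbsSpec_apply_eq G hP.continuous_pair hP.continuous_self _ _ hm]
  refine (mul_le_mul' (ENNReal.inv_le_inv.2 hden) hnum).trans ?_
  rw [← ENNReal.ofReal_inv_of_pos (by positivity), ← ENNReal.ofReal_mul (by positivity)]
  refine ENNReal.ofReal_le_ofReal ?_
  have e : (Real.exp (-D) * B)⁻¹ * (Real.exp D * A) = Real.exp (Real.log (A / B) + 2 * D) := by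
    rw [Real.exp_add (Real.log _), Real.exp_log (by positivity), two_mul, Real.exp_add D,
      Real.exp_neg]
    field_simp
  rw [e]
  refine Real.exp_le_exp.2 ?_
  have := le_abs_self (Real.log (A / B))
  rw [hD]
  linarith

/-- The logarithm of the exponential moment of the spin at `x` under the local Gibbs measure. -/
noncomputable def logMoment (W : ℝ → ℝ → ℝ) (U : ℝ → ℝ) (p lam : ℝ) (Λ : Finset V) (ξ : V → ℝ)
    (x : V) : ℝ :=
  Real.log (∫⁻ η, ENNReal.ofReal (Real.exp (lam * |η x| ^ p)) ∂gibbsSpec G W U Λ ξ).toReal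

theorem one_le_lintegral_exp_gibbsSpec (hP : IsStablePotential W U r q I J a c) (hrp : r ≤ p)
    (hpq : p < q) {lam : ℝ} (hlam : 0 ≤ lam) (Λ : Finset V) (ξ : V → ℝ) (x : V) :
    1 ≤ ∫⁻ η, ENNReal.ofReal (Real.exp (lam * |η x| ^ p)) ∂gibbsSpec G W U Λ ξ := by
  have := isProbabilityMeasure_gibbsSpec G hP.continuous_pair hP.continuous_self
    (partition_ne_zero G hP Λ ξ) (partition_ne_top G hP hrp hpq Λ ξ)
  calc (1 : ℝ≥0∞) = ∫⁻ _, 1 ∂gibbsSpec G W U Λ ξ := by simp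
    _ ≤ _ := lintegral_mono fun η => by
      rw [ENNReal.one_le_ofReal]
      exact Real.one_le_exp (by positivity)

theorem lintegral_exp_gibbsSpec_ne_top (hP : IsStablePotential W U r q I J a c) (hrp : r ≤ p)
    (hpq : p < q) {lam : ℝ} (hlam : 0 ≤ lam) (Λ : Finset V) (ξ : V → ℝ) {x : V} (hx : x ∈ Λ) :
    ∫⁻ η, ENNReal.ofReal (Real.exp (lam * |η x| ^ p)) ∂gibbsSpec G W U Λ ξ ≠ ∞ := by
  rw [gibbsSpec_apply_eq G hP.continuous_pair hP.continuous_self _ _ (by fun_prop)]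
  refine ENNReal.mul_ne_top (ENNReal.inv_ne_top.2 (partition_ne_zero G hP Λ ξ)) ?_
  refine ne_top_of_le_ne_top (spinIntegral_exp_ne_top G hP hrp hpq Λ ξ hlam)
    (spinIntegral_mono fun η _ => mul_le_mul' le_rfl (ENNReal.ofReal_le_ofReal
      (Real.exp_le_exp.2 (mul_le_mul_of_nonneg_left ?_ hlam))))
  exact Finset.single_le_sum (f := fun z => |η z| ^ p) (fun _ _ => by positivity) hx

theorem ofReal_exp_logMoment (hP : IsStablePotential W U r q I J a c) (hrp : r ≤ p)
    (hpq : p < q) {lam : ℝ} (hlam : 0 ≤ lam) (Λ : Finset V) (ξ : V → ℝ) {x : V} (hx : x ∈ Λ) :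
    ENNReal.ofReal (Real.exp (logMoment G W U p lam Λ ξ x)) =
      ∫⁻ η, ENNReal.ofReal (Real.exp (lam * |η x| ^ p)) ∂gibbsSpec G W U Λ ξ := by
  have h1 := one_le_lintegral_exp_gibbsSpec G hP hrp hpq hlam Λ ξ x
  have h2 := lintegral_exp_gibbsSpec_ne_top G hP hrp hpq hlam Λ ξ hx
  rw [logMoment, Real.exp_log (ENNReal.toReal_pos (zero_lt_one.trans_le h1).ne' h2),
    ENNReal.ofReal_toReal h2]

theorem logMoment_nonneg (hP : IsStablePotential W U r q I J a c) (hrp : r ≤ p)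
    (hpq : p < q) {lam : ℝ} (hlam : 0 ≤ lam) (Λ : Finset V) (ξ : V → ℝ) {x : V} (hx : x ∈ Λ) :
    0 ≤ logMoment G W U p lam Λ ξ x := by
  refine Real.log_nonneg ?_
  have h := ENNReal.toReal_mono (lintegral_exp_gibbsSpec_ne_top G hP hrp hpq hlam Λ ξ hx)
    (one_le_lintegral_exp_gibbsSpec G hP hrp hpq hlam Λ ξ x)
  simpa using h

open Classical in
/-- The profile that equals the rescaled logarithmic moments in `Λ` and `|ξ|^p` off `Λ`. -/
noncomputable def momentProfile (W : ℝ → ℝ → ℝ) (U : ℝ → ℝ) (p lam : ℝ) (Λ : Finset V)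
    (ξ : V → ℝ) (y : V) : ℝ :=
  if y ∈ Λ then logMoment G W U p lam Λ ξ y / lam else |ξ y| ^ p

theorem momentProfile_nonneg (hP : IsStablePotential W U r q I J a c) (hrp : r ≤ p)
    (hpq : p < q) {lam : ℝ} (hlam : 0 ≤ lam) (Λ : Finset V) (ξ : V → ℝ) (y : V) :
    0 ≤ momentProfile G W U p lam Λ ξ y := by
  unfold momentProfile
  split_ifs with h
  · exact div_nonneg (logMoment_nonneg G hP hrp hpq hlam Λ ξ h) hlam
  · positivity

/-- A one-site bound propagates to logarithmic moments in a finite volume. -/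
theorem logMoment_le (hP : IsStablePotential W U r q I J a c) (hrp : r ≤ p) (hpq : p < q)
    {lam ε : ℝ} (hlam : 0 < lam) (hε : 0 < ε) (hεlam : ε ≤ lam) {x : V} {C : ℝ}
    (hC : ∀ ξ : V → ℝ, ∫⁻ η, ENNReal.ofReal (Real.exp (lam * |η x| ^ p)) ∂gibbsSpec G W U {x} ξ ≤
      ENNReal.ofReal (Real.exp (C + ε * neighborMean G (fun y => |ξ y| ^ p) x)))
    {Λ : Finset V} (hx : x ∈ Λ) (ξ : V → ℝ) :
    logMoment G W U p lam Λ ξ x ≤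
      C + ε * neighborMean G (momentProfile G W U p lam Λ ξ) x := by
  classical
  have hZ : ∀ (Λ : Finset V) (ξ : V → ℝ),
      partition G W U Λ ξ ≠ 0 ∧ partition G W U Λ ξ ≠ ∞ := fun Λ ξ =>
    ⟨partition_ne_zero G hP Λ ξ, partition_ne_top G hP hrp hpq Λ ξ⟩
  have := isProbabilityMeasure_gibbsSpec G hP.continuous_pair hP.continuous_self
    (hZ Λ ξ).1 (hZ Λ ξ).2
  set N : V → ℝ := fun y => (G.degree x : ℝ) * G.degree y with hN
  set Nin := (G.neighborFinset x).filter (· ∈ Λ) with hNin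
  set Nout := (G.neighborFinset x).filter (· ∉ Λ) with hNout
  have hN0 : ∀ y, 0 ≤ N y := fun y => by positivity
  set Sout := ∑ y ∈ Nout, |ξ y| ^ p / N y with hSout
  have hsplit : ∀ η : V → ℝ, (∀ y ∉ Λ, η y = ξ y) →
      C + ε * neighborMean G (fun y => |η y| ^ p) x =
        (C + ε * Sout) + ∑ y ∈ Nin, ε / lam * (N y)⁻¹ * (lam * |η y| ^ p) := fun η hη => by
    have h1 : ∑ y ∈ Nout, |η y| ^ p / N y = Sout :=
      Finset.sum_congr rfl fun y hy => by rw [hη y (Finset.mem_filter.1 hy).2]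
    have h2 : ∑ y ∈ Nin, ε / lam * (N y)⁻¹ * (lam * |η y| ^ p) =
        ε * ∑ y ∈ Nin, |η y| ^ p / N y := by
      rw [Finset.mul_sum]
      refine Finset.sum_congr rfl fun y _ => ?_
      field_simp
    rw [neighborMean, ← Finset.sum_filter_add_sum_filter_not _ (· ∈ Λ), h2, ← h1]
    ring
  -- The exponents ε/(λ N y) have sum at most ε/λ ≤ 1.
  have hHolder := lintegral_exp_sum_le (gibbsSpec G W U Λ ξ) Nin
    (t := fun y => ε / lam * (N y)⁻¹) (h := fun y η => lam * |η y| ^ p)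
    (b := logMoment G W U p lam Λ ξ)
    (fun y _ => mul_nonneg (by positivity) (inv_nonneg.2 (hN0 y)))
    (by
      rw [← Finset.mul_sum]
      refine mul_le_one₀ ((div_le_one hlam).2 hεlam)
        (Finset.sum_nonneg fun y _ => inv_nonneg.2 (hN0 y)) ?_
      refine (Finset.sum_le_sum_of_subset_of_nonneg (Finset.filter_subset _ _)
        fun y _ _ => inv_nonneg.2 (hN0 y)).trans (sum_inv_degree_mul_degree_le G x))
    (fun y => by fun_prop)
    (fun y hy => (ofReal_exp_logMoment G hP hrp hpq hlam.le Λ ξ (Finset.mem_filter.1 hy).2).ge)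
  -- Consistency for {x} ⊆ Λ inserts the one-site bound under π_Λ; spins off Λ are frozen at ξ and
  -- leave the integral as a constant factor.
  have hmain : ENNReal.ofReal (Real.exp (logMoment G W U p lam Λ ξ x)) ≤
      ENNReal.ofReal (Real.exp ((C + ε * Sout) +
        ∑ y ∈ Nin, ε / lam * (N y)⁻¹ * logMoment G W U p lam Λ ξ y)) := by
    rw [ofReal_exp_logMoment G hP hrp hpq hlam.le Λ ξ hx,
      ← lintegral_lintegral_gibbsSpec G hP.continuous_pair hP.symm hP.continuous_self hZ
        (Finset.singleton_subset_iff.2 hx) ξ (by fun_prop)]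
    calc _ ≤ ∫⁻ η, ENNReal.ofReal (Real.exp (C + ε * neighborMean G (fun y => |η y| ^ p) x))
            ∂gibbsSpec G W U Λ ξ := lintegral_mono hC
      _ = ∫⁻ η, ENNReal.ofReal (Real.exp (C + ε * Sout)) * ENNReal.ofReal (Real.exp
            (∑ y ∈ Nin, ε / lam * (N y)⁻¹ * (lam * |η y| ^ p))) ∂gibbsSpec G W U Λ ξ := by
          refine lintegral_gibbsSpec_congr G hP.continuous_pair hP.continuous_self ?_ ?_ ?_
          · unfold neighborMean; fun_prop
          · fun_prop
          · intro η hη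
            rw [hsplit η hη, Real.exp_add, ENNReal.ofReal_mul (Real.exp_pos _).le]
      _ ≤ _ := by
          rw [lintegral_const_mul _ (by fun_prop), Real.exp_add (C + ε * Sout),
            ENNReal.ofReal_mul (Real.exp_pos _).le]
          exact mul_le_mul' le_rfl hHolder
  rw [ENNReal.ofReal_le_ofReal_iff (Real.exp_pos _).le, Real.exp_le_exp] at hmain
  refine hmain.trans (le_of_eq ?_)
  rw [neighborMean, ← Finset.sum_filter_add_sum_filter_not (G.neighborFinset x) (· ∈ Λ)]
  have h1 : ∑ y ∈ Nout, momentProfile G W U p lam Λ ξ y / N y = Sout :=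
    Finset.sum_congr rfl fun y hy => by
      rw [momentProfile, if_neg (Finset.mem_filter.1 hy).2]
  have h2 : ∑ y ∈ Nin, ε / lam * (N y)⁻¹ * logMoment G W U p lam Λ ξ y =
      ε * ∑ y ∈ Nin, momentProfile G W U p lam Λ ξ y / N y := by
    rw [Finset.mul_sum]
    refine Finset.sum_congr rfl fun y hy => ?_
    rw [momentProfile, if_pos (Finset.mem_filter.1 hy).2]
    field_simp
  rw [h2, ← h1]
  ring

/-- After exchanging the sums, w(x) ≤ e^α w(y) for neighbours, and the factors 1/(n(x)n(y)) around y
sum to at most 1. -/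
theorem sum_weight_mul_neighborMean_le (hG : G.Connected) (o : V) {α : ℝ} (hα : 0 ≤ α)
    {h : V → ℝ} (hh : ∀ y, 0 ≤ h y) {Λ S : Finset V} (hS : ∀ x ∈ Λ, G.neighborFinset x ⊆ S) :
    ∑ x ∈ Λ, weight G o α x * neighborMean G h x ≤
      Real.exp α * ∑ y ∈ S, weight G o α y * h y := by
  classical
  have hw : ∀ y, 0 < weight G o α y := fun y => Real.exp_pos _
  calc ∑ x ∈ Λ, weight G o α x * neighborMean G h x
      = ∑ x ∈ Λ, ∑ y ∈ G.neighborFinset x,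
          weight G o α x * (h y / ((G.degree x : ℝ) * G.degree y)) := by
        simp only [neighborMean, Finset.mul_sum]
    _ = ∑ y ∈ S, ∑ x ∈ (G.neighborFinset y).filter (· ∈ Λ),
          weight G o α x * (h y / ((G.degree x : ℝ) * G.degree y)) := by
        refine Finset.sum_comm' fun x y => ?_
        simp only [Finset.mem_filter, SimpleGraph.mem_neighborFinset]
        constructor
        · rintro ⟨hx, hy⟩
          exact ⟨⟨hy.symm, hx⟩, hS x hx (by simpa using hy)⟩
        · rintro ⟨⟨hy, hx⟩, -⟩
          exact ⟨hx, hy.symm⟩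
    _ ≤ ∑ y ∈ S, Real.exp α * (weight G o α y * h y) *
          ∑ x ∈ G.neighborFinset y, ((G.degree y : ℝ) * G.degree x)⁻¹ := by
        refine Finset.sum_le_sum fun y _ => ?_
        rw [Finset.mul_sum]
        have h0 : 0 ≤ Real.exp α * (weight G o α y * h y) :=
          mul_nonneg (Real.exp_pos _).le (mul_nonneg (hw y).le (hh y))
        refine (Finset.sum_le_sum fun x hx => ?_).trans
          (Finset.sum_le_sum_of_subset_of_nonneg (Finset.filter_subset _ _)
            fun x _ _ => mul_nonneg h0 (by positivity))
        have hadj : G.Adj x y := by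
          have := (Finset.mem_filter.1 hx).1
          rw [SimpleGraph.mem_neighborFinset] at this
          exact this.symm
        have h1 := weight_le_exp_mul_weight G hG o hα hadj
        have h2 := one_le_degree_mul_degree G hadj.symm
        rw [mul_comm (G.degree x : ℝ), div_eq_mul_inv, ← mul_assoc, ← mul_assoc]
        exact mul_le_mul_of_nonneg_right (mul_le_mul_of_nonneg_right h1 (hh y)) (by positivity)
    _ ≤ ∑ y ∈ S, Real.exp α * (weight G o α y * h y) := by
        refine Finset.sum_le_sum fun y _ => mul_le_of_le_one_right ?_
          (sum_inv_degree_mul_degree_le G y)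
        exact mul_nonneg (Real.exp_pos _).le (mul_nonneg (hw y).le (hh y))
    _ = _ := by rw [Finset.mul_sum]

open Classical in
/-- The outer boundary of a finite set of vertices. -/
noncomputable def outerBoundary (Λ : Finset V) : Finset V :=
  (Λ.biUnion fun x => G.neighborFinset x) \ Λ

/-- The weighted sum of logarithmic moments in a finite volume, in terms of the boundary spins. -/
theorem exists_sum_weight_mul_logMoment_le (hG : G.Connected) (o : V)
    (hP : IsStablePotential W U r q I J a c) (hθ : 0 < θ) (hp : r + r / θ ≤ p) (hpq : p < q)
    {α : ℝ} (hα : 0 ≤ α) (hw : Summable (weight G o α))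
    (hdw : Summable fun x => degreeSum G θ x * weight G o α x) {lam : ℝ} (hlam : 0 < lam) :
    ∃ A : ℝ, ∀ (Λ : Finset V) (ξ : V → ℝ),
      ∑ x ∈ Λ, weight G o α x * logMoment G W U p lam Λ ξ x ≤
        A + lam * ∑ y ∈ outerBoundary G Λ, weight G o α y * |ξ y| ^ p := by
  classical
  have hrp : r ≤ p := le_trans (le_add_of_nonneg_right (div_pos hP.r_pos hθ).le) hp
  -- Since ε e^α = λ/2, the sum over Λ reappears on the right with coefficient 1/2. Absorbing it
  -- doubles the rest, which gives `2 * S₁` and the factor λ at the boundary.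
  set ε := lam * Real.exp (-α) / 2 with hεdef
  have hε : 0 < ε := by positivity
  have hεlam : ε ≤ lam := by
    have : Real.exp (-α) ≤ 1 := Real.exp_le_one_iff.2 (by linarith)
    rw [hεdef]; nlinarith
  have hεα : ε * Real.exp α = lam / 2 := by
    rw [hεdef, Real.exp_neg]; field_simp
  obtain ⟨C₁, C₂, hC₁, hC₂, hC⟩ := exists_one_site_bound G hP hθ hp hpq hlam.le hε
  have hw0 : ∀ y, 0 < weight G o α y := fun y => Real.exp_pos _
  have hd0 : ∀ x, 0 ≤ degreeSum G θ x := fun x => by unfold degreeSum; positivity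
  set S₁ := C₁ * ∑' x, weight G o α x + C₂ * ∑' x, degreeSum G θ x * weight G o α x with hS₁
  refine ⟨2 * S₁, fun Λ ξ => ?_⟩
  set prof := momentProfile G W U p lam Λ ξ with hprof
  have hprof0 := momentProfile_nonneg G hP hrp hpq hlam.le Λ ξ
  have hS : ∀ x ∈ Λ, G.neighborFinset x ⊆ Λ ∪ outerBoundary G Λ := fun x hx => by
    rw [outerBoundary, Finset.union_sdiff_self_eq_union]
    exact (Finset.subset_biUnion_of_mem (fun x => G.neighborFinset x) hx).trans
      Finset.subset_union_right
  have h1 : ∑ x ∈ Λ, weight G o α x * logMoment G W U p lam Λ ξ x ≤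
      ∑ x ∈ Λ, (C₁ * weight G o α x + C₂ * (degreeSum G θ x * weight G o α x) +
        ε * (weight G o α x * neighborMean G prof x)) :=
    Finset.sum_le_sum fun x hx => by
      have := mul_le_mul_of_nonneg_left
        (logMoment_le G hP hrp hpq hlam hε hεlam (hC x) hx ξ) (hw0 x).le
      rw [← hprof] at this
      linarith
  rw [Finset.sum_add_distrib, Finset.sum_add_distrib, ← Finset.mul_sum, ← Finset.mul_sum,
    ← Finset.mul_sum] at h1
  have h2 : ∑ x ∈ Λ, weight G o α x ≤ ∑' x, weight G o α x :=
    hw.sum_le_tsum _ fun x _ => (hw0 x).le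
  have h3 : ∑ x ∈ Λ, degreeSum G θ x * weight G o α x ≤
      ∑' x, degreeSum G θ x * weight G o α x :=
    hdw.sum_le_tsum _ fun x _ => mul_nonneg (hd0 x) (hw0 x).le
  have h4 := mul_le_mul_of_nonneg_left
    (sum_weight_mul_neighborMean_le G hG o hα hprof0 hS) hε.le
  rw [← hprof, ← mul_assoc, hεα, Finset.sum_union (by
    rw [outerBoundary]; exact Finset.disjoint_sdiff)] at h4
  have h5 : ∑ y ∈ Λ, weight G o α y * prof y =
      (∑ x ∈ Λ, weight G o α x * logMoment G W U p lam Λ ξ x) / lam := by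
    rw [Finset.sum_div]
    refine Finset.sum_congr rfl fun y hy => ?_
    rw [hprof, momentProfile, if_pos hy, mul_div_assoc]
  have h6 : ∑ y ∈ outerBoundary G Λ, weight G o α y * prof y =
      ∑ y ∈ outerBoundary G Λ, weight G o α y * |ξ y| ^ p :=
    Finset.sum_congr rfl fun y hy => by
      rw [hprof, momentProfile, if_neg (Finset.mem_sdiff.1 hy).2]
  rw [h5, h6, mul_add] at h4
  have h7 : lam / 2 * ((∑ x ∈ Λ, weight G o α x * logMoment G W U p lam Λ ξ x) / lam) =
      (∑ x ∈ Λ, weight G o α x * logMoment G W U p lam Λ ξ x) / 2 := by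
    field_simp
  have h8 := mul_le_mul_of_nonneg_left h2 hC₁
  have h9 := mul_le_mul_of_nonneg_left h3 hC₂
  linarith

/-- The finite-volume exponential moments of the weighted norm. -/
theorem exists_lintegral_exp_sum_gibbsSpec_le (hG : G.Connected) (o : V)
    (hP : IsStablePotential W U r q I J a c) (hθ : 0 < θ) (hp : r + r / θ ≤ p) (hpq : p < q)
    {α : ℝ} (hα : 0 ≤ α) (hw : Summable (weight G o α))
    (hdw : Summable fun x => degreeSum G θ x * weight G o α x) {lam : ℝ} (hlam : 0 < lam) :
    ∃ A : ℝ, ∀ (Λ : Finset V) (ξ : V → ℝ),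
      ∫⁻ η, ENNReal.ofReal (Real.exp (lam * ∑ x ∈ Λ, |η x| ^ p * weight G o α x))
          ∂gibbsSpec G W U Λ ξ ≤
        ENNReal.ofReal (Real.exp
          (A + lam * ∑ y ∈ outerBoundary G Λ, |ξ y| ^ p * weight G o α y)) := by
  have hrp : r ≤ p := le_trans (le_add_of_nonneg_right (div_pos hP.r_pos hθ).le) hp
  have hw0 : ∀ y, 0 < weight G o α y := fun y => Real.exp_pos _
  set s := ∑' x, weight G o α x with hs
  have hs0 : 0 < s := hw.tsum_pos (fun x => (hw0 x).le) o (hw0 o)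
  obtain ⟨A, hA⟩ := exists_sum_weight_mul_logMoment_le G hG o hP hθ hp hpq hα hw hdw
    (mul_pos hlam hs0)
  refine ⟨A / s, fun Λ ξ => ?_⟩
  have := isProbabilityMeasure_gibbsSpec G hP.continuous_pair hP.continuous_self
    (partition_ne_zero G hP Λ ξ) (partition_ne_top G hP hrp hpq Λ ξ)
  -- The exponents w(y)/s have sum at most 1; the logarithmic moments are taken at λs to compensate
  -- for the division by s.
  have hHolder := lintegral_exp_sum_le (gibbsSpec G W U Λ ξ) Λ
    (t := fun y => weight G o α y / s) (h := fun y η => lam * s * |η y| ^ p)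
    (b := logMoment G W U p (lam * s) Λ ξ)
    (fun y _ => div_nonneg (hw0 y).le hs0.le)
    (by
      rw [← Finset.sum_div, div_le_one hs0]
      exact hw.sum_le_tsum _ fun x _ => (hw0 x).le)
    (fun y => by fun_prop)
    (fun y hy => (ofReal_exp_logMoment G hP hrp hpq (by positivity) Λ ξ hy).ge)
  have e1 : ∀ η : V → ℝ, ∑ y ∈ Λ, weight G o α y / s * (lam * s * |η y| ^ p) =
      lam * ∑ x ∈ Λ, |η x| ^ p * weight G o α x := fun η => by
    rw [Finset.mul_sum]
    refine Finset.sum_congr rfl fun y _ => ?_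
    field_simp
  simp only [e1] at hHolder
  refine hHolder.trans (ENNReal.ofReal_le_ofReal (Real.exp_le_exp.2 ?_))
  have h1 := div_le_div_of_nonneg_right (hA Λ ξ) hs0.le
  rw [Finset.sum_div] at h1
  have e2 : (A + lam * s * ∑ y ∈ outerBoundary G Λ, weight G o α y * |ξ y| ^ p) / s =
      A / s + lam * ∑ y ∈ outerBoundary G Λ, |ξ y| ^ p * weight G o α y := by
    simp only [mul_comm (weight G o α _)]
    field_simp
  rw [e2] at h1
  refine le_trans (le_of_eq (Finset.sum_congr rfl fun y _ => ?_)) h1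
  ring

end

/-! ### Weak continuity, tightness and infinite-volume Gibbs measures. -/

section

theorem exists_boundedContinuous_eq {Ω : Type*} [TopologicalSpace Ω] {h : Ω → ℝ≥0∞}
    (hh : Continuous h) {M : ℝ≥0∞} (hM : M ≠ ∞) (hle : ∀ ω, h ω ≤ M) :
    ∃ f : BoundedContinuousFunction Ω NNReal, ∀ ω, (f ω : ℝ≥0∞) = h ω := by
  have hfin : ∀ ω, h ω ≠ ∞ := fun ω => ne_top_of_le_ne_top hM (hle ω)
  have hc : Continuous fun ω => (h ω).toNNReal :=
    continuous_iff_continuousAt.2 fun ω =>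
      (ENNReal.tendsto_toNNReal (hfin ω)).comp (hh.tendsto ω)
  refine ⟨BoundedContinuousFunction.mkOfBound ⟨_, hc⟩ M.toNNReal fun ω ω' => ?_,
    fun ω => ENNReal.coe_toNNReal (hfin ω)⟩
  have hb : ∀ ω, ((h ω).toNNReal : ℝ) ≤ M.toNNReal := fun ω =>
    NNReal.coe_le_coe.2 (ENNReal.toNNReal_mono hM (hle ω))
  have h1 := hb ω
  have h2 := hb ω'
  rw [NNReal.dist_eq, abs_le]
  constructor <;> simp only [ContinuousMap.coe_mk] <;>
    linarith [(h ω).toNNReal.coe_nonneg, (h ω').toNNReal.coe_nonneg]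

theorem continuous_lintegral_boundedContinuous {Ω : Type*} [TopologicalSpace Ω]
    [MeasurableSpace Ω] [OpensMeasurableSpace Ω] (f : BoundedContinuousFunction Ω NNReal) :
    Continuous fun μ : ProbabilityMeasure Ω => ∫⁻ ω, f ω ∂(μ : Measure Ω) :=
  continuous_iff_continuousAt.2 fun _ =>
    ProbabilityMeasure.tendsto_iff_forall_lintegral_tendsto.1 Filter.tendsto_id f

theorem continuous_lintegral_probabilityMeasure {Ω : Type*} [TopologicalSpace Ω]
    [MeasurableSpace Ω] [OpensMeasurableSpace Ω] {h : Ω → ℝ≥0∞} (hh : Continuous h) {M : ℝ≥0∞}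
    (hM : M ≠ ∞) (hle : ∀ ω, h ω ≤ M) :
    Continuous fun μ : ProbabilityMeasure Ω => ∫⁻ ω, h ω ∂(μ : Measure Ω) := by
  obtain ⟨f, hf⟩ := exists_boundedContinuous_eq hh hM hle
  simp only [← hf]
  exact continuous_lintegral_boundedContinuous f

theorem lintegral_le_of_forall_lintegral_min_le {Ω : Type*} [MeasurableSpace Ω] {μ : Measure Ω}
    {h : Ω → ℝ≥0∞} (hh : Measurable h) {C : ℝ≥0∞}
    (hC : ∀ n : ℕ, ∫⁻ ω, min (h ω) n ∂μ ≤ C) : ∫⁻ ω, h ω ∂μ ≤ C := by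
  have e : ∀ ω, h ω = ⨆ n : ℕ, min (h ω) n := fun ω => by
    rw [← inf_iSup_eq, ENNReal.iSup_natCast, inf_top_eq]
  calc ∫⁻ ω, h ω ∂μ = ∫⁻ ω, ⨆ n : ℕ, min (h ω) n ∂μ := lintegral_congr e
    _ = ⨆ n : ℕ, ∫⁻ ω, min (h ω) n ∂μ := by
        refine lintegral_iSup (fun n => hh.min measurable_const) fun m n hmn ω => ?_
        exact min_le_min le_rfl (by exact_mod_cast hmn)
    _ ≤ C := iSup_le hC

/-- The integral is the supremum of its truncations at n, each weakly continuous in μ, hence lower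
semicontinuous. -/
theorem isClosed_setOf_lintegral_le {Ω : Type*} [TopologicalSpace Ω] [MeasurableSpace Ω]
    [OpensMeasurableSpace Ω] {h : Ω → ℝ≥0∞} (hh : Continuous h) (C : ℝ≥0∞) :
    IsClosed {μ : ProbabilityMeasure Ω | ∫⁻ ω, h ω ∂(μ : Measure Ω) ≤ C} := by
  have e : {μ : ProbabilityMeasure Ω | ∫⁻ ω, h ω ∂(μ : Measure Ω) ≤ C} =
      ⋂ n : ℕ, {μ : ProbabilityMeasure Ω | ∫⁻ ω, min (h ω) n ∂(μ : Measure Ω) ≤ C} := by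
    ext μ
    simp only [Set.mem_ofPred_eq, Set.mem_iInter]
    exact ⟨fun hμ n => (lintegral_mono fun ω => min_le_left _ _).trans hμ,
      lintegral_le_of_forall_lintegral_min_le hh.measurable⟩
  rw [e]
  exact isClosed_iInter fun n => isClosed_le
    (continuous_lintegral_probabilityMeasure (hh.min continuous_const)
      (ENNReal.natCast_ne_top n) fun ω => min_le_right _ _) continuous_const

variable {V : Type*}

theorem summable_degreeSum_mul_weight (G : SimpleGraph V) [G.LocallyFinite] {o : V} {α θ : ℝ}
    (h : Theta G o α θ < ∞) : Summable fun x => degreeSum G θ x * weight G o α x := by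
  have h0 : ∀ x, 0 ≤ degreeSum G θ x * weight G o α x := fun x =>
    mul_nonneg (by unfold degreeSum; positivity) (Real.exp_pos _).le
  refine (ENNReal.summable_toReal h.ne).congr fun x => ?_
  rw [ENNReal.toReal_ofReal (h0 x)]

/-- If there are two vertices, connectedness gives every vertex a neighbour, so m_θ ≥ 1 and w is
dominated. For a single vertex m_θ = 0, but the sum is finite anyway. -/
theorem summable_weight (G : SimpleGraph V) [G.LocallyFinite] (hG : G.Connected) {o : V}
    {α θ : ℝ} (hθ : 0 < θ) (h : Theta G o α θ < ∞) : Summable (weight G o α) := by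
  rcases subsingleton_or_nontrivial V with hV | hV
  · exact Summable.of_finite
  refine (summable_degreeSum_mul_weight G h).of_nonneg_of_le (fun x => (Real.exp_pos _).le)
    fun x => le_mul_of_one_le_left (Real.exp_pos _).le ?_
  obtain ⟨y, hy⟩ := (G.degree_pos_iff_exists_adj x).1 (hG.preconnected.degree_pos_of_nontrivial x)
  calc (1 : ℝ) ≤ ((G.degree x : ℝ) * G.degree y) ^ θ :=
        Real.one_le_rpow (one_le_degree_mul_degree G hy) hθ.le
    _ ≤ degreeSum G θ x := Finset.single_le_sum
        (f := fun y => ((G.degree x : ℝ) * (G.degree y : ℝ)) ^ θ) (fun _ _ => by positivity)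
        (by simpa using hy)

/-! ### The weighted norm and the compact sets of measures with bounded moment. -/

section Energy

variable (G : SimpleGraph V) (o : V) (p α : ℝ)

theorem weighted_nonneg (ω : V → ℝ) (x : V) : 0 ≤ |ω x| ^ p * weight G o α x :=
  mul_nonneg (by positivity) (Real.exp_pos _).le

theorem lpNorm_rpow {p : ℝ} (hp : 0 < p) (ω : V → ℝ) :
    lpNorm G o p α ω ^ p = ∑' x, ENNReal.ofReal (|ω x| ^ p * weight G o α x) := by
  rw [lpNorm, ← ENNReal.rpow_mul, one_div, inv_mul_cancel₀ hp.ne', ENNReal.rpow_one]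

theorem mem_lpSpace_iff {p : ℝ} (hp : 0 < p) (ω : V → ℝ) :
    ω ∈ lpSpace G o p α ↔ ∑' x, ENNReal.ofReal (|ω x| ^ p * weight G o α x) ≠ ∞ := by
  rw [← lpNorm_rpow G o α hp, lpSpace, Set.mem_ofPred_eq, lt_top_iff_ne_top, not_iff_not,
    ENNReal.rpow_eq_top_iff_of_pos hp]

theorem summable_of_mem_lpSpace {p : ℝ} (hp : 0 < p) {ω : V → ℝ} (h : ω ∈ lpSpace G o p α) :
    Summable fun x => |ω x| ^ p * weight G o α x := by
  rw [mem_lpSpace_iff G o α hp] at h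
  refine (ENNReal.summable_toReal h).congr fun x => ?_
  rw [ENNReal.toReal_ofReal (weighted_nonneg G o p α ω x)]

theorem exp_lpNorm_eq {p : ℝ} (hp : 0 < p) {ω : V → ℝ} (h : ω ∈ lpSpace G o p α) (lam : ℝ) :
    EReal.exp ((lam : EReal) * ((lpNorm G o p α ω ^ p : ℝ≥0∞) : EReal)) =
      ENNReal.ofReal (Real.exp (lam * ∑' x, |ω x| ^ p * weight G o α x)) := by
  rw [lpNorm_rpow G o α hp, ← ENNReal.ofReal_tsum_of_nonneg (weighted_nonneg G o p α ω)
    (summable_of_mem_lpSpace G o α hp h), EReal.coe_ennreal_ofReal,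
    max_eq_left (tsum_nonneg (weighted_nonneg G o p α ω)), ← EReal.coe_mul, EReal.exp_coe]

variable [Countable V]

theorem measurableSet_lpSpace {p : ℝ} (hp : 0 < p) : MeasurableSet (lpSpace G o p α) := by
  have : lpSpace G o p α =
      {ω | ∑' x, ENNReal.ofReal (|ω x| ^ p * weight G o α x) = ∞}ᶜ := by
    ext ω
    exact mem_lpSpace_iff G o α hp ω
  rw [this]
  exact ((Measurable.tsum fun x => by fun_prop) (measurableSet_singleton ∞)).compl

theorem ae_mem_lpSpace {p : ℝ} (hp : 0 < p) {μ : ProbabilityMeasure (V → ℝ)}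
    (h : (μ : Measure (V → ℝ)) (lpSpace G o p α) = 1) :
    ∀ᵐ ω ∂(μ : Measure (V → ℝ)), ω ∈ lpSpace G o p α :=
  (prob_compl_eq_zero_iff (measurableSet_lpSpace G o α hp)).2 h

/-- Exponential integrability of the norm follows from that of its finite truncations. -/
theorem lintegral_exp_lpNorm_le {p : ℝ} (hp : 0 < p) {μ : ProbabilityMeasure (V → ℝ)}
    (h : (μ : Measure (V → ℝ)) (lpSpace G o p α) = 1) {lam : ℝ} (hlam : 0 ≤ lam) {C : ℝ≥0∞}
    (hC : ∀ Δ : Finset V, ∫⁻ ω, ENNReal.ofReal (Real.exp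
      (lam * ∑ x ∈ Δ, |ω x| ^ p * weight G o α x)) ∂(μ : Measure (V → ℝ)) ≤ C) :
    ∫⁻ ω, EReal.exp ((lam : EReal) * ((lpNorm G o p α ω ^ p : ℝ≥0∞) : EReal))
      ∂(μ : Measure (V → ℝ)) ≤ C := by
  have hmono : Monotone fun (Δ : Finset V) (ω : V → ℝ) => ENNReal.ofReal (Real.exp
      (lam * ∑ x ∈ Δ, |ω x| ^ p * weight G o α x)) := fun Δ Δ' hΔ ω =>
    ENNReal.ofReal_le_ofReal (Real.exp_le_exp.2 (mul_le_mul_of_nonneg_left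
      (Finset.sum_le_sum_of_subset_of_nonneg hΔ fun x _ _ => weighted_nonneg G o p α ω x) hlam))
  calc _ ≤ ∫⁻ ω, ⨆ Δ : Finset V, ENNReal.ofReal (Real.exp
          (lam * ∑ x ∈ Δ, |ω x| ^ p * weight G o α x)) ∂(μ : Measure (V → ℝ)) := by
        refine lintegral_mono_ae ?_
        filter_upwards [ae_mem_lpSpace G o α hp h] with ω hω
        rw [exp_lpNorm_eq G o α hp hω]
        have hs := (summable_of_mem_lpSpace G o α hp hω).hasSum
        have hc : Continuous fun t : ℝ => ENNReal.ofReal (Real.exp (lam * t)) :=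
          ENNReal.continuous_ofReal.comp (by fun_prop)
        exact le_of_tendsto' ((hc.tendsto _).comp hs) fun Δ =>
          le_iSup (fun Δ : Finset V => ENNReal.ofReal (Real.exp
            (lam * ∑ x ∈ Δ, |ω x| ^ p * weight G o α x))) Δ
    _ = ⨆ Δ : Finset V, ∫⁻ ω, ENNReal.ofReal (Real.exp
          (lam * ∑ x ∈ Δ, |ω x| ^ p * weight G o α x)) ∂(μ : Measure (V → ℝ)) :=
        lintegral_iSup_directed (fun Δ => Measurable.aemeasurable (by fun_prop)) hmono.directed_le
    _ ≤ C := iSup_le hC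

/-- The probability measures whose mean of `‖ω‖_{p,α}^p` is at most `C`. -/
def boundedMoment (C : ℝ≥0∞) : Set (ProbabilityMeasure (V → ℝ)) :=
  {μ | ∀ Δ : Finset V, ∫⁻ ω, ENNReal.ofReal (∑ x ∈ Δ, |ω x| ^ p * weight G o α x)
    ∂(μ : Measure (V → ℝ)) ≤ C}

theorem lintegral_tsum_le_of_mem_boundedMoment {C : ℝ≥0∞} {μ : ProbabilityMeasure (V → ℝ)}
    (hμ : μ ∈ boundedMoment G o p α C) :
    ∫⁻ ω, ∑' x, ENNReal.ofReal (|ω x| ^ p * weight G o α x) ∂(μ : Measure (V → ℝ)) ≤ C := by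
  rw [lintegral_tsum fun x => Measurable.aemeasurable (by fun_prop), ENNReal.tsum_eq_iSup_sum]
  refine iSup_le fun Δ => ?_
  rw [← lintegral_finsetSum _ fun x _ => by fun_prop]
  refine le_trans (le_of_eq (lintegral_congr fun ω => ?_)) (hμ Δ)
  rw [ENNReal.ofReal_sum_of_nonneg fun x _ => weighted_nonneg G o p α ω x]

theorem measure_lpSpace_of_mem_boundedMoment {p : ℝ} (hp : 0 < p) {C : ℝ≥0∞} (hC : C ≠ ∞)
    {μ : ProbabilityMeasure (V → ℝ)} (hμ : μ ∈ boundedMoment G o p α C) :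
    (μ : Measure (V → ℝ)) (lpSpace G o p α) = 1 := by
  rw [← prob_compl_eq_zero_iff (measurableSet_lpSpace G o α hp)]
  have := ae_lt_top' (μ := (μ : Measure (V → ℝ)))
    (f := fun ω : V → ℝ => ∑' x, ENNReal.ofReal (|ω x| ^ p * weight G o α x))
    (Measurable.tsum fun x => by fun_prop).aemeasurable
    (ne_top_of_le_ne_top hC (lintegral_tsum_le_of_mem_boundedMoment G o p α hμ))
  change ∀ᵐ ω ∂(μ : Measure (V → ℝ)), ω ∈ lpSpace G o p α
  filter_upwards [this] with ω hω
  exact (mem_lpSpace_iff G o α hp ω).2 hω.ne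

theorem isClosed_boundedMoment {p : ℝ} (hp : 0 < p) (C : ℝ≥0∞) :
    IsClosed (boundedMoment G o p α C) := by
  have : boundedMoment G o p α C = ⋂ Δ : Finset V, {μ : ProbabilityMeasure (V → ℝ) |
      ∫⁻ ω, ENNReal.ofReal (∑ x ∈ Δ, |ω x| ^ p * weight G o α x)
        ∂(μ : Measure (V → ℝ)) ≤ C} := by
    ext μ
    simp only [boundedMoment, Set.mem_ofPred_eq, Set.mem_iInter]
  rw [this]
  refine isClosed_iInter fun Δ => isClosed_setOf_lintegral_le ?_ C
  have : ∀ x, Continuous fun ω : V → ℝ => |ω x| ^ p := fun x =>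
    (continuous_apply x).abs.rpow_const fun _ => Or.inr hp.le
  exact ENNReal.continuous_ofReal.comp (by fun_prop)

/-- The compact sets are boxes of half-width (R/w(x))^(1/p) at x. Leaving the box at one site
already makes the weighted sum exceed R, which by Markov's inequality has probability at most C/R.
-/
theorem isTightMeasureSet_boundedMoment {p : ℝ} (hp : 0 < p) {C : ℝ≥0∞} (hC : C ≠ ∞) :
    IsTightMeasureSet {((μ : ProbabilityMeasure (V → ℝ)) : Measure (V → ℝ)) |
      μ ∈ boundedMoment G o p α C} := by
  rw [isTightMeasureSet_iff_exists_isCompact_measure_compl_le]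
  intro ε hε
  obtain ⟨R, hR0, hR⟩ : ∃ R : ℝ, 0 < R ∧ C / ENNReal.ofReal R ≤ ε := by
    rcases eq_or_ne ε ∞ with rfl | hε'
    · exact ⟨1, one_pos, le_top⟩
    refine ⟨(C / ε).toReal + 1, by positivity, ?_⟩
    refine ENNReal.div_le_of_le_mul' ?_
    have h1 : C / ε ≤ ENNReal.ofReal ((C / ε).toReal + 1) := by
      refine (ENNReal.ofReal_toReal (ENNReal.div_ne_top hC hε.ne')).ge.trans ?_
      exact ENNReal.ofReal_le_ofReal (by linarith)
    exact (ENNReal.div_le_iff hε.ne' hε').1 h1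
  have hw : ∀ x, 0 < weight G o α x := fun x => Real.exp_pos _
  refine ⟨Set.pi Set.univ fun x => Set.Icc (-(R / weight G o α x) ^ p⁻¹)
    ((R / weight G o α x) ^ p⁻¹), isCompact_univ_pi fun x => isCompact_Icc, ?_⟩
  rintro _ ⟨μ, hμ, rfl⟩
  refine le_trans (measure_mono (t := {ω : V → ℝ | ENNReal.ofReal R ≤
    ∑' x, ENNReal.ofReal (|ω x| ^ p * weight G o α x)}) ?_) ?_
  · intro ω hω
    rw [Set.mem_compl_iff, Set.mem_univ_pi, not_forall] at hω
    obtain ⟨x, hx⟩ := hω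
    rw [Set.mem_Icc, ← abs_le, Real.le_rpow_inv_iff_of_pos (abs_nonneg _)
      (div_nonneg hR0.le (hw x).le) hp, not_le, div_lt_iff₀ (hw x)] at hx
    exact (ENNReal.ofReal_le_ofReal hx.le).trans
      (ENNReal.le_tsum (f := fun x => ENNReal.ofReal (|ω x| ^ p * weight G o α x)) x)
  · refine (meas_ge_le_lintegral_div (Measurable.tsum fun x => by fun_prop).aemeasurable
      (ENNReal.ofReal_pos.2 hR0).ne' ENNReal.ofReal_ne_top).trans (le_trans ?_ hR)
    exact ENNReal.div_le_div_right (lintegral_tsum_le_of_mem_boundedMoment G o p α hμ) _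

theorem isCompact_boundedMoment {p : ℝ} (hp : 0 < p) {C : ℝ≥0∞} (hC : C ≠ ∞) :
    IsCompact (boundedMoment G o p α C) := by
  have := isCompact_closure_of_isTightMeasureSet (isTightMeasureSet_boundedMoment G o α hp hC)
  rwa [(isClosed_boundedMoment G o α hp C).closure_eq] at this

end Energy

/-! ### Tempered Gibbs measures: uniform moments, closedness and existence. -/

variable (G : SimpleGraph V) [G.LocallyFinite] {W : ℝ → ℝ → ℝ} {U : ℝ → ℝ}
  {r q I J a c p θ α : ℝ}

/-- The outer boundary is disjoint from Λ, so its sum is part of a vanishing tail. -/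
theorem tendsto_sum_outerBoundary {f : V → ℝ} (hf : Summable f) :
    Filter.Tendsto (fun Λ : Finset V => ∑ y ∈ outerBoundary G Λ, f y) Filter.atTop (nhds 0) := by
  intro e he
  obtain ⟨s, hs⟩ := summable_iff_vanishing.1 hf e he
  rw [Filter.mem_map]
  filter_upwards [Filter.mem_atTop s] with Λ hΛ
  refine hs _ ?_
  classical
  rw [outerBoundary]
  exact Finset.disjoint_of_subset_right hΛ Finset.sdiff_disjoint

/-- The zero boundary condition removes the boundary term and all contributions of Δ outside Λ; then
t ≤ e^t. -/
theorem gibbsSpec_zero_mem_boundedMoment (o : V) (hp : 0 < p)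
    (hP : IsStablePotential W U r q I J a c) {A : ℝ}
    (hA : ∀ (Λ : Finset V) (ξ : V → ℝ),
      ∫⁻ η, ENNReal.ofReal (Real.exp (1 * ∑ x ∈ Λ, |η x| ^ p * weight G o α x))
          ∂gibbsSpec G W U Λ ξ ≤
        ENNReal.ofReal (Real.exp
          (A + 1 * ∑ y ∈ outerBoundary G Λ, |ξ y| ^ p * weight G o α y)))
    (Λ : Finset V) (hprob : IsProbabilityMeasure (gibbsSpec G W U Λ 0)) :
    (⟨gibbsSpec G W U Λ 0, hprob⟩ : ProbabilityMeasure (V → ℝ)) ∈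
      boundedMoment G o p α (ENNReal.ofReal (Real.exp A)) := by
  classical
  intro Δ
  have h0 : ∀ η : V → ℝ, (∀ x ∉ Λ, η x = (0 : V → ℝ) x) →
      ∑ x ∈ Δ, |η x| ^ p * weight G o α x =
        ∑ x ∈ Δ ∩ Λ, |η x| ^ p * weight G o α x := fun η hη => by
    refine (Finset.sum_subset Finset.inter_subset_left fun x hxΔ hx => ?_).symm
    rw [hη x fun hxΛ => hx (Finset.mem_inter.2 ⟨hxΔ, hxΛ⟩)]
    simp [Real.zero_rpow hp.ne']
  rw [ProbabilityMeasure.coe_mk, lintegral_gibbsSpec_congr G hP.continuous_pair hP.continuous_self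
    (g := fun η => ENNReal.ofReal (∑ x ∈ Δ ∩ Λ, |η x| ^ p * weight G o α x)) (by fun_prop)
    (by fun_prop) fun η hη => by rw [h0 η hη]]
  refine le_trans (lintegral_mono fun η => ENNReal.ofReal_le_ofReal ?_)
    ((hA Λ 0).trans (le_of_eq ?_))
  · rw [one_mul]
    have h1 : ∑ x ∈ Δ ∩ Λ, |η x| ^ p * weight G o α x ≤
        ∑ x ∈ Λ, |η x| ^ p * weight G o α x :=
      Finset.sum_le_sum_of_subset_of_nonneg Finset.inter_subset_right
        fun x _ _ => weighted_nonneg G o p α η x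
    linarith [Real.add_one_le_exp (∑ x ∈ Λ, |η x| ^ p * weight G o α x)]
  · simp [Real.zero_rpow hp.ne']

variable [Countable V]

/-- Gibbs measures are characterized by the equilibrium equation for bounded continuous
functions. -/
theorem mem_gibbsMeasures_iff (hP : IsStablePotential W U r q I J a c)
    {μ : ProbabilityMeasure (V → ℝ)} :
    μ ∈ gibbsMeasures G W U ↔ ∀ Λ : Finset V, Λ.Nonempty →
      ∀ f : BoundedContinuousFunction (V → ℝ) NNReal,
      ∫⁻ ξ, ∫⁻ η, f η ∂gibbsSpec G W U Λ ξ ∂(μ : Measure (V → ℝ)) =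
        ∫⁻ η, f η ∂(μ : Measure (V → ℝ)) := by
  have hm := measurable_gibbsSpec G hP.continuous_pair hP.continuous_self
  constructor
  · intro hμ Λ hΛ f
    exact lintegral_lintegral_gibbsSpec_of_mem G hP.continuous_pair hP.continuous_self hμ hΛ
      f.continuous.measurable.coe_nnreal_ennreal
  · intro h
    rw [bind_gibbsSpec_of_mem G hP.continuous_pair hP.continuous_self]
    intro Λ hΛ
    symm
    refine ext_of_forall_lintegral_eq_of_IsFiniteMeasure fun f => ?_
    rw [Measure.lintegral_bind (hm Λ).aemeasurable
      f.continuous.measurable.coe_nnreal_ennreal.aemeasurable, h Λ hΛ f]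

theorem continuous_lintegral_lintegral_gibbsSpec (hP : IsStablePotential W U r q I J a c)
    (hrp : r ≤ p) (hpq : p < q) (Λ : Finset V)
    (f : BoundedContinuousFunction (V → ℝ) NNReal) :
    Continuous fun μ : ProbabilityMeasure (V → ℝ) =>
      ∫⁻ ξ, ∫⁻ η, f η ∂gibbsSpec G W U Λ ξ ∂(μ : Measure (V → ℝ)) := by
  have hfM : ∀ η, (f η : ℝ≥0∞) ≤ (nndist f 0 : ℝ≥0∞) := fun η => by
    rw [ENNReal.coe_le_coe]
    simpa using f.nndist_coe_le_nndist (g := 0) η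
  refine continuous_lintegral_probabilityMeasure (continuous_lintegral_gibbsSpec G hP hrp hpq Λ
    (ENNReal.continuous_coe.comp f.continuous) ENNReal.coe_ne_top hfM) ENNReal.coe_ne_top
    (fun ξ => ?_) (M := (nndist f 0 : ℝ≥0∞))
  have := isProbabilityMeasure_gibbsSpec G hP.continuous_pair hP.continuous_self
    (partition_ne_zero G hP Λ ξ) (partition_ne_top G hP hrp hpq Λ ξ)
  calc ∫⁻ η, f η ∂gibbsSpec G W U Λ ξ ≤ ∫⁻ _, (nndist f 0 : ℝ≥0∞) ∂gibbsSpec G W U Λ ξ :=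
        lintegral_mono hfM
    _ = _ := by simp

theorem isClosed_gibbsMeasures (hP : IsStablePotential W U r q I J a c) (hrp : r ≤ p)
    (hpq : p < q) : IsClosed (gibbsMeasures G W U) := by
  have : gibbsMeasures G W U = ⋂ (Λ : Finset V) (_ : Λ.Nonempty)
      (f : BoundedContinuousFunction (V → ℝ) NNReal), {μ : ProbabilityMeasure (V → ℝ) |
        ∫⁻ ξ, ∫⁻ η, f η ∂gibbsSpec G W U Λ ξ ∂(μ : Measure (V → ℝ)) =
          ∫⁻ η, f η ∂(μ : Measure (V → ℝ))} := by
    ext μ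
    simp only [mem_gibbsMeasures_iff G hP, Set.mem_iInter, Set.mem_ofPred_eq]
  rw [this]
  exact isClosed_iInter fun Λ => isClosed_iInter fun _ => isClosed_iInter fun f =>
    isClosed_eq (continuous_lintegral_lintegral_gibbsSpec G hP hrp hpq Λ f)
      (continuous_lintegral_boundedContinuous f)

/-- Exponential moments in finite volumes are inherited by tempered Gibbs measures. -/
theorem lintegral_exp_sum_le_of_mem_temperedGibbs (o : V) (hp : 0 < p)
    (hP : IsStablePotential W U r q I J a c) (hrp : r ≤ p) (hpq : p < q) {lam A : ℝ}
    (hlam : 0 < lam)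
    (hA : ∀ (Λ : Finset V) (ξ : V → ℝ),
      ∫⁻ η, ENNReal.ofReal (Real.exp (lam * ∑ x ∈ Λ, |η x| ^ p * weight G o α x))
          ∂gibbsSpec G W U Λ ξ ≤
        ENNReal.ofReal (Real.exp
          (A + lam * ∑ y ∈ outerBoundary G Λ, |ξ y| ^ p * weight G o α y)))
    {μ : ProbabilityMeasure (V → ℝ)} (hμ : μ ∈ temperedGibbs G o W U p α) (Δ : Finset V) :
    ∫⁻ ω, ENNReal.ofReal (Real.exp (lam * ∑ x ∈ Δ, |ω x| ^ p * weight G o α x))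
      ∂(μ : Measure (V → ℝ)) ≤ ENNReal.ofReal (Real.exp A) := by
  -- Integrability of the boundary factor under μ is not known; truncation at n is what permits
  -- dominated convergence.
  refine lintegral_le_of_forall_lintegral_min_le (by fun_prop) fun n => ?_
  have hlim : Filter.Tendsto (fun Λ : Finset V => ∫⁻ ξ, min (ENNReal.ofReal (Real.exp
      (A + lam * ∑ y ∈ outerBoundary G Λ, |ξ y| ^ p * weight G o α y))) n
        ∂(μ : Measure (V → ℝ))) Filter.atTop
      (nhds (∫⁻ _, min (ENNReal.ofReal (Real.exp A)) n ∂(μ : Measure (V → ℝ)))) := by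
    refine tendsto_lintegral_filter_of_dominated_convergence (fun _ => n)
      (Filter.Eventually.of_forall fun Λ => by fun_prop)
      (Filter.Eventually.of_forall fun Λ => Filter.Eventually.of_forall fun ξ => min_le_right _ _)
      (by simp) ?_
    filter_upwards [ae_mem_lpSpace G o α hp hμ.2] with ξ hξ
    have h1 := tendsto_sum_outerBoundary G (summable_of_mem_lpSpace G o α hp hξ)
    have hc : Continuous fun t : ℝ =>
        min (ENNReal.ofReal (Real.exp (A + lam * t))) (n : ℝ≥0∞) :=
      (ENNReal.continuous_ofReal.comp (by fun_prop)).min continuous_const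
    have h2 := (hc.tendsto 0).comp h1
    simp only [mul_zero, add_zero] at h2
    exact h2
  refine (ge_of_tendsto hlim ?_).trans ?_
  -- Requiring o ∈ Λ keeps Λ non-empty, as the DLR equation demands.
  · filter_upwards [Filter.eventually_ge_atTop Δ, Filter.eventually_ge_atTop {o}] with Λ hΛ ho
    rw [← lintegral_lintegral_gibbsSpec_of_mem G hP.continuous_pair hP.continuous_self hμ.1
      (⟨o, ho (Finset.mem_singleton_self o)⟩ : Λ.Nonempty) (by fun_prop)]
    refine lintegral_mono fun ξ => le_min ?_ ?_
    · refine le_trans (lintegral_mono fun η => (min_le_left _ _).trans ?_) (hA Λ ξ)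
      exact ENNReal.ofReal_le_ofReal (Real.exp_le_exp.2 (mul_le_mul_of_nonneg_left
        (Finset.sum_le_sum_of_subset_of_nonneg hΛ fun x _ _ => weighted_nonneg G o p α η x)
        hlam.le))
    · have := isProbabilityMeasure_gibbsSpec G hP.continuous_pair hP.continuous_self
        (partition_ne_zero G hP Λ ξ) (partition_ne_top G hP hrp hpq Λ ξ)
      calc _ ≤ ∫⁻ _, (n : ℝ≥0∞) ∂gibbsSpec G W U Λ ξ :=
            lintegral_mono fun η => min_le_right _ _
        _ = n := by simp
  · simp

/-- Almost sure finiteness of the norm improves itself, through the DLR equation, to a bound common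
to all tempered Gibbs measures; conversely a finite mean gives almost sure finiteness. -/
theorem temperedGibbs_eq (o : V) (hp : 0 < p) (hP : IsStablePotential W U r q I J a c)
    (hrp : r ≤ p) (hpq : p < q) {A : ℝ}
    (hA : ∀ (Λ : Finset V) (ξ : V → ℝ),
      ∫⁻ η, ENNReal.ofReal (Real.exp (1 * ∑ x ∈ Λ, |η x| ^ p * weight G o α x))
          ∂gibbsSpec G W U Λ ξ ≤
        ENNReal.ofReal (Real.exp
          (A + 1 * ∑ y ∈ outerBoundary G Λ, |ξ y| ^ p * weight G o α y))) :
    temperedGibbs G o W U p α =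
      boundedMoment G o p α (ENNReal.ofReal (Real.exp A)) ∩ gibbsMeasures G W U := by
  ext μ
  constructor
  · intro hμ
    refine ⟨fun Δ => le_trans (lintegral_mono fun ω => ENNReal.ofReal_le_ofReal ?_)
      (lintegral_exp_sum_le_of_mem_temperedGibbs G o hp hP hrp hpq one_pos hA hμ Δ), hμ.1⟩
    rw [one_mul]
    linarith [Real.add_one_le_exp (∑ x ∈ Δ, |ω x| ^ p * weight G o α x)]
  · rintro ⟨h1, h2⟩
    exact ⟨h2, measure_lpSpace_of_mem_boundedMoment G o α hp ENNReal.ofReal_ne_top h1⟩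

theorem nonempty_boundedMoment_inter_gibbsMeasures (o : V) (hp : 0 < p)
    (hP : IsStablePotential W U r q I J a c) (hrp : r ≤ p) (hpq : p < q) {A : ℝ}
    (hA : ∀ (Λ : Finset V) (ξ : V → ℝ),
      ∫⁻ η, ENNReal.ofReal (Real.exp (1 * ∑ x ∈ Λ, |η x| ^ p * weight G o α x))
          ∂gibbsSpec G W U Λ ξ ≤
        ENNReal.ofReal (Real.exp
          (A + 1 * ∑ y ∈ outerBoundary G Λ, |ξ y| ^ p * weight G o α y))) :
    (boundedMoment G o p α (ENNReal.ofReal (Real.exp A)) ∩ gibbsMeasures G W U).Nonempty := by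
  classical
  have hZ : ∀ (Λ : Finset V) (ξ : V → ℝ),
      partition G W U Λ ξ ≠ 0 ∧ partition G W U Λ ξ ≠ ∞ := fun Λ ξ =>
    ⟨partition_ne_zero G hP Λ ξ, partition_ne_top G hP hrp hpq Λ ξ⟩
  have hprob : ∀ Λ : Finset V, IsProbabilityMeasure (gibbsSpec G W U Λ 0) := fun Λ =>
    isProbabilityMeasure_gibbsSpec G hP.continuous_pair hP.continuous_self (hZ Λ 0).1 (hZ Λ 0).2
  set ν : Finset V → ProbabilityMeasure (V → ℝ) := fun Λ => ⟨gibbsSpec G W U Λ 0, hprob Λ⟩ with hν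
  -- Along an ultrafilter finer than `atTop` the measures converge by compactness, and every fixed Δ
  -- is eventually contained in Λ. For such Λ consistency gives the equilibrium equation exactly,
  -- and the Feller property carries it to the limit.
  set F : Ultrafilter (Finset V) := Ultrafilter.of Filter.atTop with hF
  have hFle : (F : Filter (Finset V)) ≤ Filter.atTop := Ultrafilter.of_le _
  obtain ⟨μ, hμ, hlim⟩ := (isCompact_boundedMoment G o α hp
    (ENNReal.ofReal_ne_top (r := Real.exp A))).ultrafilter_le_nhds' (F.map ν)
      (Filter.mem_map.2 <| Filter.Eventually.of_forall fun Λ : Finset V =>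
        gibbsSpec_zero_mem_boundedMoment G o hp hP hA Λ (hprob Λ))
  have hlim : Filter.Tendsto ν F (nhds μ) := hlim
  refine ⟨μ, hμ, (mem_gibbsMeasures_iff G hP).2 fun Δ _ f => ?_⟩
  refine tendsto_nhds_unique_of_eventuallyEq
    (((continuous_lintegral_lintegral_gibbsSpec G hP hrp hpq Δ f).tendsto μ).comp hlim)
    (((continuous_lintegral_boundedContinuous f).tendsto μ).comp hlim) ?_
  filter_upwards [hFle (Filter.mem_atTop Δ)] with Λ hΛ
  exact lintegral_lintegral_gibbsSpec G hP.continuous_pair hP.symm hP.continuous_self hZ hΛ 0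
    f.continuous.measurable.coe_nnreal_ennreal

end

end UnboundedSpin

/-! ### The main theorem. -/

open UnboundedSpin in
theorem theorem3p1 {V : Type*} [Countable V] (G : SimpleGraph V) [G.LocallyFinite]
    (hG : G.Connected) (o : V)
    (W : ℝ → ℝ → ℝ) (U : ℝ → ℝ) (θ r q I_W J_W a_V c_V : ℝ)
    (hθ : 0 < θ) (hΘ : ∃ α : ℝ, 0 < α ∧ UnboundedSpin.Theta G o α θ < ∞)
    (hWcont : Continuous (fun z : ℝ × ℝ => W z.1 z.2))
    (hWsymm : ∀ u v, W u v = W v u)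
    (hr : 0 < r) (hI : 0 < I_W) (hJ : 0 < J_W)
    (hW : ∀ u v, |W u v| ≤ (I_W + J_W * (|u| ^ r + |v| ^ r)) / 2)
    (hUcont : Continuous U) (ha : 0 < a_V) (hc : 0 < c_V)
    (hU : ∀ u, a_V * |u| ^ q - c_V ≤ U u)
    (hq : r + r / θ < q)
    (αbar : ℝ) (hαbar : UnboundedSpin.alphaLow G o θ < αbar)
    (hαbarΘ : ∀ α ∈ Set.Ioc (UnboundedSpin.alphaLow G o θ) αbar,
      UnboundedSpin.Theta G o α θ < ∞)
    (α : ℝ) (hα : α ∈ Set.Ioc (UnboundedSpin.alphaLow G o θ) αbar)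
    (p : ℝ) (hp : p ∈ Set.Ico (r + r / θ) q) :
    (UnboundedSpin.temperedGibbs G o W U p α).Nonempty ∧
    IsCompact (UnboundedSpin.temperedGibbs G o W U p α) ∧
    (∀ lam : ℝ, 0 < lam → ∀ x : V, ∃ C : ℝ, 0 < C ∧
      ∀ μ ∈ UnboundedSpin.temperedGibbs G o W U p α,
        ∫⁻ ω, ENNReal.ofReal (Real.exp (lam * |ω x| ^ p)) ∂(μ : Measure (V → ℝ))
          ≤ ENNReal.ofReal C) ∧
    (∀ lam : ℝ, 0 < lam → ∃ C : ℝ, 0 < C ∧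
      ∀ μ ∈ UnboundedSpin.temperedGibbs G o W U p α,
        ∫⁻ ω, EReal.exp ((lam : EReal) * ((UnboundedSpin.lpNorm G o p α ω ^ p : ℝ≥0∞) : EReal))
          ∂(μ : Measure (V → ℝ)) ≤ ENNReal.ofReal C) := by
  have hP : IsStablePotential W U r q I_W J_W a_V c_V :=
    ⟨hWcont, hWsymm, hr, hI, hJ, hW, hUcont, ha, hU⟩
  have hrp : r ≤ p := le_trans (le_add_of_nonneg_right (div_pos hr hθ).le) hp.1
  have hp0 : 0 < p := hr.trans_le hrp
  have hα0 : 0 ≤ α := le_trans (Real.sInf_nonneg fun _ h => h.1.le) hα.1.le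
  have hT := hαbarΘ α hα
  have hbound := fun (lam : ℝ) (hlam : 0 < lam) =>
    exists_lintegral_exp_sum_gibbsSpec_le G hG o hP hθ hp.1 hp.2 hα0
      (summable_weight G hG hθ hT) (summable_degreeSum_mul_weight G hT) hlam
  obtain ⟨A, hA⟩ := hbound 1 one_pos
  have heq := temperedGibbs_eq G o hp0 hP hrp hp.2 hA
  refine ⟨?_, ?_, fun lam hlam x => ?_, fun lam hlam => ?_⟩
  · rw [heq]
    exact nonempty_boundedMoment_inter_gibbsMeasures G o hp0 hP hrp hp.2 hA
  · rw [heq]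
    exact (isCompact_boundedMoment G o α hp0 ENNReal.ofReal_ne_top).inter_right
      (isClosed_gibbsMeasures G hP hrp hp.2)
  · have hw : 0 < weight G o α x := Real.exp_pos _
    -- Dividing by w(x) turns the weighted bound for Δ = {x} into the plain moment at x.
    obtain ⟨B, hB⟩ := hbound (lam / weight G o α x) (by positivity)
    refine ⟨Real.exp B, Real.exp_pos _, fun μ hμ => ?_⟩
    refine le_trans (le_of_eq (lintegral_congr fun ω => ?_))
      (lintegral_exp_sum_le_of_mem_temperedGibbs G o hp0 hP hrp hp.2 (by positivity) hB hμ {x})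
    rw [Finset.sum_singleton]
    congr 2
    field_simp
  · obtain ⟨B, hB⟩ := hbound lam hlam
    exact ⟨Real.exp B, Real.exp_pos _, fun μ hμ => lintegral_exp_lpNorm_le G o α hp0 hμ.2 hlam.le
      fun Δ => lintegral_exp_sum_le_of_mem_temperedGibbs G o hp0 hP hrp hp.2 hlam hB hμ Δ⟩
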